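/- **Setting.** Let $M_4=\mathbb R^4$ carry the Minkowski form $x\cdot y=x^0y^0-x^1y^1-x^2y^2-x^3y^3$, $x^2=x\cdot x$, let $V_+=\{x: x^2>0,\ x^0>0\}$, and let $\overline{V_+}$ be its closure. For $O\subset M_4$ put $O'=\{x:(x-y)^2<0\ \text{for all}\ y\in O\}$; $O_1,O_2$ are *causally separated* if $O_1\subset O_2'$. A *double cone* is a set $(p+V_+)\cap(q-V_+)$ with $q-p\in V_+$. Let $\mathcal K$ be a set of nonempty bounded subsets of $M_4$ which contains all double cones and is stable under the restricted Poincaré group $\mathcal P_+^\uparrow$. Let $\{\mathcal A(O)\}_{O\in\mathcal K}$ be a local net of observables: $\mathcal A$ is a unital $C^*$-algebra and the $\mathcal A(O)\subset\mathcal A$ are $C^*$-subalgebras containing $1$ which are $W^*$-algebras; $\mathcal A(O_1)\subset\mathcal A(O_2)$ if $O_1\subset O_2$; $\mathcal A(O_1)$ and $\mathcal A(O_2)$ commute if $O_1,O_2$ are causally separated; $\bigcup_O\mathcal A(O)$ is norm dense in $\mathcal A$; and there is an action $\alpha$ of $\mathcal P_+^\uparrow$ on $\mathcal A$ by $*$-automorphisms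 with $\alpha_g(\mathcal A(O))=\mathcal A(gO)$, strongly continuous in the sense that $\varphi(|\alpha_g(X)-\alpha_{g_0}(X)|^2)\to0$ as $g\to g_0$ for all $X\in\mathcal A$ and all locally normal positive functionals $\varphi$ (those whose restriction to each $\mathcal A(O)$ is normal). For $O\subset M_4$ let $\mathcal A(O')$ be the $C^*$-algebra generated by the $\mathcal A(O_1)$ with $O_1\in\mathcal K$, $O_1\subset O'$. Let $\mathcal K_\Subset$ be the set of pairs $\Lambda=(O_1^\Lambda,O_2^\Lambda)$ in $\mathcal K\times\mathcal K$ with $\overline{O_1^\Lambda}\subsetneq O_2^\Lambda$, and $\mathcal K_\Subset^{DC}$ the set of those consisting of double cones. The net is assumed to have *property B*: for every $\Lambda\in\mathcal K_\Subset$ and every nonzero projection $E\in\mathcal A(O_1^\Lambda)$ there is $W\in\mathcal A(O_2^\Lambda)$ with $W^*W=1$, $WW^*=E$. Let $\omega_0$ be a vacuum state: a locally normal $\mathcal P_+^\uparrow$-invariant state on $\mathcal A$ whose GNS representation $(\pi_0,\mathcal H_0,\Omega)$ is irreducible on a separable Hilbert space, such that $\Omega$ is cyclic and separating for $\pi_0(\mathcal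 A(O))$ for all $O\in\mathcal K$, and such that $\alpha$ is implemented on $\mathcal H_0$ by a strongly continuous unitary representation of the universal covering group $\mathbb R^4\rtimes SL(2,\mathbb C)$ of $\mathcal P_+^\uparrow$ which fixes $\Omega$ and whose translation subgroup has its joint spectrum in $\overline{V_+}$. Assume Haag duality: $\pi_0(\mathcal A(O'))'=\pi_0(\mathcal A(O))''$ for every double cone $O$. For a representation $\pi$ of $\mathcal A$ put $\pi^d(O)=\pi(\mathcal A(O'))'$. **Definitions.** A *local state* with inclusion pair $\Lambda\in\mathcal K_\Subset$ is a unital completely positive map $T:\mathcal A\to\mathcal A$ such that $T(AB)=T(A)B$ for all $A\in\mathcal A$, $B\in\mathcal A((O_2^\Lambda)')$, and such that for some normal state $\varphi$ on $\mathcal A(O_1^\Lambda)$, $T(A)=\varphi(A)1$ for all $A\in\mathcal A(O_1^\Lambda)$. Let $(\pi_{T,0},\mathcal K_{T,0},V_{T,0})$ be the minimal Stinespring representation of $\pi_0\circ T$. A representation $\pi$ of $\mathcal A$ has *property DHR* if for every $\Lambda\in\mathcal K_\Subset^{DC}$ and every nonzero projection $E\in\pi^d(O_1^\Lambda)$ there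 is $W\in\pi^d(O_2^\Lambda)$ with $W^*W=1$ and $WW^*=E$; $T$ has property DHR if $\pi_{T,0}$ does. A *localized endomorphism with support in $O$* is a $*$-endomorphism $\rho$ of $\pi_0(\mathcal A)$ which is the identity on $\pi_0(\mathcal A(O'))$. It is *transportable* if for every $a\in\mathbb R^4$ there are a localized endomorphism $\rho'$ with support in $O+a$ and a unitary $U\in\pi_0(\mathcal A)''$ with $\rho=\mathrm{Ad}\,U\circ\rho'$. Let $T$ be a local state with inclusion pair $\Lambda\in\mathcal K_\Subset^{DC}$. A localized endomorphism $\rho$ with support in a double cone $O\supseteq O_2^\Lambda$ *corresponds to* $T$ if there is $V\in\pi_0^d(O)$ such that $(\rho\circ\pi_0,\mathcal H_0,V)$ is a minimal Stinespring representation of $\pi_0\circ T$; in particular $(\pi_0\circ T)(X)=V^*\rho(\pi_0(X))V$ for $X\in\mathcal A$. **Corollary.** Let $\Lambda_1,\Lambda_2\in\mathcal K_\Subset^{DC}$ be such that $O_2^{\Lambda_1}$ and $O_2^{\Lambda_2}$ are causally separated, and let $T_j$ be a local state with inclusion pair $\Lambda_j$ which has property DHR ($j=1,2$). If the localized endomorphisms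 corresponding to $T_1$ and to $T_2$ (with supports in double cones containing $O_2^{\Lambda_1}$, respectively $O_2^{\Lambda_2}$) are transportable, then $$\pi_0\circ(T_1\circ T_2)=\pi_0\circ(T_2\circ T_1).$$ -/

import Mathlib

open Set Filter Topology MeasureTheory
open scoped ComplexConjugate InnerProductSpace CStarAlgebra ComplexOrder Matrix

universe u v w z

noncomputable section

/-! ### Four-dimensional Minkowski space and the Poincare group -/

/-- Four-dimensional space-time; coordinate `0` is time. -/
abbrev M4 : Type := Fin 4 → ℝ

/-- The Minkowski form, of signature `(+,-,-,-)`. -/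
def mink (x y : M4) : ℝ := x 0 * y 0 - x 1 * y 1 - x 2 * y 2 - x 3 * y 3

/-- The open forward light cone `V₊`. -/
def forwardCone : Set M4 := {x | 0 < mink x x ∧ 0 < x 0}

/-- The closed forward light cone. -/
def closedForwardCone : Set M4 := {x | 0 ≤ mink x x ∧ 0 ≤ x 0}

/-- The causal complement: the points that are spacelike to every point of the region. -/
def causalComplement (O : Set M4) : Set M4 := {x | ∀ y ∈ O, mink (x - y) (x - y) < 0}

/-- Causal separation of two regions. -/
def CausallySeparated (O₁ O₂ : Set M4) : Prop := O₁ ⊆ causalComplement O₂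

/-- (Open, nonempty) double cones `(p + V₊) ∩ (q - V₊)` with `q - p ∈ V₊`. -/
def IsDoubleCone (O : Set M4) : Prop :=
  ∃ p q : M4, q - p ∈ forwardCone ∧ O = {x | x - p ∈ forwardCone ∧ q - x ∈ forwardCone}

/-- The translate `O + a`. -/
def translateRegion (a : M4) (O : Set M4) : Set M4 := (fun x => x + a) '' O

/-- The restricted (proper orthochronous) Lorentz group: linear isomorphisms that preserve the
Minkowski form, have positive determinant and map the forward cone into itself. -/
def restrictedLorentz : Subgroup (M4 ≃ₗ[ℝ] M4) where
  carrier := {L | (∀ x y, mink (L x) (L y) = mink x y) ∧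
    0 < LinearMap.det (L : M4 →ₗ[ℝ] M4) ∧ ∀ x ∈ forwardCone, L x ∈ forwardCone}
  one_mem' := by
    refine ⟨fun x y => rfl, ?_, fun x hx => hx⟩
    have h : ((1 : M4 ≃ₗ[ℝ] M4) : M4 →ₗ[ℝ] M4) = LinearMap.id := rfl
    rw [h, LinearMap.det_id]
    exact one_pos
  mul_mem' := by
    rintro L M ⟨h1, h2, h3⟩ ⟨k1, k2, k3⟩
    refine ⟨fun x y => (h1 _ _).trans (k1 x y), ?_, fun x hx => h3 _ (k3 x hx)⟩
    have h : ((L * M : M4 ≃ₗ[ℝ] M4) : M4 →ₗ[ℝ] M4)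
        = (L : M4 →ₗ[ℝ] M4) ∘ₗ (M : M4 →ₗ[ℝ] M4) := rfl
    rw [h, LinearMap.det_comp]
    exact mul_pos h2 k2
  inv_mem' := by
    rintro L ⟨h1, h2, h3⟩
    have hL : ∀ x, L (L⁻¹ x) = x := fun x => L.apply_symm_apply x
    have key : ∀ x y, mink (L⁻¹ x) (L⁻¹ y) = mink x y := fun x y => by
      rw [← h1, hL, hL]
    refine ⟨key, ?_, fun x hx => ?_⟩
    · have h : ((L⁻¹ : M4 ≃ₗ[ℝ] M4) : M4 →ₗ[ℝ] M4) ∘ₗ (L : M4 →ₗ[ℝ] M4) = LinearMap.id := by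
        refine LinearMap.ext fun x => ?_
        exact L.symm_apply_apply x
      have h' := congrArg LinearMap.det h
      rw [LinearMap.det_comp, LinearMap.det_id] at h'
      exact pos_of_mul_pos_left (by rw [h']; exact one_pos) h2.le
    · refine ⟨by rw [key]; exact hx.1, ?_⟩
      by_contra hneg
      have hq : 0 < mink (L⁻¹ x) (L⁻¹ x) := by rw [key]; exact hx.1
      have hne : (L⁻¹ x) 0 ≠ 0 := by
        intro h0
        unfold mink at hq
        rw [h0] at hq
        nlinarith [mul_self_nonneg ((L⁻¹ x) 1), mul_self_nonneg ((L⁻¹ x) 2),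
          mul_self_nonneg ((L⁻¹ x) 3)]
      have hm : -(L⁻¹ x) ∈ forwardCone := by
        refine ⟨?_, ?_⟩
        · have : mink (-(L⁻¹ x)) (-(L⁻¹ x)) = mink (L⁻¹ x) (L⁻¹ x) := by
            simp only [mink, Pi.neg_apply]; ring
          rw [this]; exact hq
        · have : (L⁻¹ x) 0 < 0 := lt_of_le_of_ne (not_lt.mp hneg) hne
          simpa using this
      have h4 := (h3 _ hm).2
      rw [map_neg, hL] at h4
      have h5 := hx.2
      simp only [Pi.neg_apply] at h4
      linarith

/-- The restricted Poincare group: the affine transformations `x ↦ L x + a` of space-time with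
`L` in the restricted Lorentz group. -/
def Poincare : Subgroup (M4 ≃ᵃ[ℝ] M4) := restrictedLorentz.comap AffineEquiv.linearHom

/-- The Poincare group carries the topology of pointwise convergence on space-time. -/
instance : TopologicalSpace Poincare :=
  TopologicalSpace.induced (fun g => ((g : M4 ≃ᵃ[ℝ] M4) : M4 → M4)) inferInstance

/-- The image of a region under a Poincare transformation. -/
def poincareImage (g : Poincare) (O : Set M4) : Set M4 := (g : M4 ≃ᵃ[ℝ] M4) '' O

/-- The Hermitian matrix `x⁰ + x¹σ₁ + x²σ₂ + x³σ₃` of a space-time vector. -/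
def hermitianOf (x : M4) : Matrix (Fin 2) (Fin 2) ℂ :=
  !![(x 0 + x 3 : ℂ), x 1 - Complex.I * x 2; x 1 + Complex.I * x 2, x 0 - x 3]

/-- The action of `SL(2, ℂ)` on space-time through the covering map onto the restricted Lorentz
group: the vector whose Hermitian matrix is `S X Sᴴ`, with `X` the Hermitian matrix of `x`. -/
def spinAct (S : Matrix.SpecialLinearGroup (Fin 2) ℂ) (x : M4) : M4 :=
  let Y := (S : Matrix (Fin 2) (Fin 2) ℂ) * hermitianOf x * (S : Matrix (Fin 2) (Fin 2) ℂ)ᴴ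
  ![(Y 0 0 + Y 1 1).re / 2, (Y 1 0).re, (Y 1 0).im, (Y 0 0 - Y 1 1).re / 2]

/-- The element `(a, S)` of the universal covering group `ℝ⁴ ⋊ SL(2, ℂ)` lies over `g`. -/
def LiesOver (a : M4) (S : Matrix.SpecialLinearGroup (Fin 2) ℂ) (g : Poincare) : Prop :=
  ∀ x, (g : M4 ≃ᵃ[ℝ] M4) x = spinAct S x + a

/-! ### Normal functionals, commutants, Stinespring representations -/

/-- A faithful unital representation realises a star algebra as a von Neumann algebra if its range
equals its own double commutant (`Set.centralizer` is the commutant). -/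
def IsVonNeumannRealization {M : Type u} [Ring M] [StarRing M] [Algebra ℂ M]
    {L : Type v} [NormedAddCommGroup L] [InnerProductSpace ℂ L] [CompleteSpace L]
    (σ : M →⋆ₐ[ℂ] (L →L[ℂ] L)) : Prop :=
  Function.Injective σ ∧ centralizer (centralizer (range σ)) = range σ

/-- Normal linear functionals on a `W⋆`-algebra: in a realisation as a von Neumann algebra they are
of the form `A ↦ Tr (s A)` with `s` of trace class, that is `A ↦ ∑ₙ ⟪xₙ, A yₙ⟫` with
square-summable sequences of vectors. -/
def IsNormalFunctional {M : Type u} [Ring M] [StarRing M] [Algebra ℂ M] (φ : M →ₗ[ℂ] ℂ) : Prop :=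
  ∃ (L : Type u) (_ : NormedAddCommGroup L) (_ : InnerProductSpace ℂ L) (_ : CompleteSpace L)
    (σ : M →⋆ₐ[ℂ] (L →L[ℂ] L)), IsVonNeumannRealization σ ∧
    ∃ x y : ℕ → L, Summable (fun n => ‖x n‖ ^ 2) ∧ Summable (fun n => ‖y n‖ ^ 2) ∧
      ∀ A : M, HasSum (fun n => ⟪x n, σ A (y n)⟫_ℂ) (φ A)

/-- Positive linear functionals. -/
def IsPositiveFunctional {M : Type u} [Ring M] [StarRing M] [Algebra ℂ M]
    (φ : M →ₗ[ℂ] ℂ) : Prop := ∀ A : M, 0 ≤ φ (star A * A)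

/-- States. -/
def IsState {M : Type u} [Ring M] [StarRing M] [Algebra ℂ M] (φ : M →ₗ[ℂ] ℂ) : Prop :=
  IsPositiveFunctional φ ∧ φ 1 = 1

/-- `(π, K, V)` is a minimal Stinespring representation of `Φ : A → B(H)`. -/
def IsMinimalStinespring {A : Type u} [CStarAlgebra A]
    {H : Type v} [NormedAddCommGroup H] [InnerProductSpace ℂ H] [CompleteSpace H]
    {K : Type w} [NormedAddCommGroup K] [InnerProductSpace ℂ K] [CompleteSpace K]
    (Φ : A → (H →L[ℂ] H)) (π : A →⋆ₐ[ℂ] (K →L[ℂ] K)) (V : H →L[ℂ] K) : Prop :=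
  (∀ X, Φ X = ContinuousLinearMap.adjoint V ∘L π X ∘L V) ∧
  (Submodule.span ℂ {k : K | ∃ X h, k = π X (V h)}).topologicalClosure = ⊤

/-! ### Local nets of observables -/

/-- Local normality of a functional on the global algebra, relative to a family of local algebras:
the restriction to each of these is normal. -/
def IsLocallyNormal {A : Type u} [CStarAlgebra A] (regions : Set (Set M4))
    (alg : Set M4 → StarSubalgebra ℂ A) (φ : A →ₗ[ℂ] ℂ) : Prop :=
  ∀ O ∈ regions, IsNormalFunctional (φ ∘ₗ (alg O).subtype.toAlgHom.toLinearMap)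

/-- A local net of `W⋆`-algebras with global `C⋆`-algebra `A`. The values `alg O` are meaningful
only for `O ∈ regions`. -/
structure LocalNet (A : Type u) [CStarAlgebra A] where
  /-- The index set of bounded regions. -/
  regions : Set (Set M4)
  nonempty_of_mem : ∀ O ∈ regions, O.Nonempty
  bounded_of_mem : ∀ O ∈ regions, Bornology.IsBounded O
  doubleCone_mem : ∀ O, IsDoubleCone O → O ∈ regions
  image_mem : ∀ (g : Poincare), ∀ O ∈ regions, poincareImage g O ∈ regions
  /-- The local algebras, with the unit of `A`. -/
  alg : Set M4 → StarSubalgebra ℂ A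
  isClosed_alg : ∀ O ∈ regions, IsClosed (alg O : Set A)
  wstar : ∀ (O) (hO : O ∈ regions),
    haveI : IsClosed (alg O : Set A) := isClosed_alg O hO
    WStarAlgebra (alg O)
  isotony : ∀ O₁ ∈ regions, ∀ O₂ ∈ regions, O₁ ⊆ O₂ → alg O₁ ≤ alg O₂
  locality : ∀ O₁ ∈ regions, ∀ O₂ ∈ regions, CausallySeparated O₁ O₂ →
    ∀ X ∈ alg O₁, ∀ Y ∈ alg O₂, Commute X Y
  dense : Dense (⋃ O ∈ regions, (alg O : Set A))
  /-- The action of the Poincare group. -/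
  α : Poincare →* (A ≃⋆ₐ[ℂ] A)
  covariance : ∀ (g : Poincare), ∀ O ∈ regions, α g '' (alg O : Set A) = alg (poincareImage g O)
  /-- Strong continuity, in the topology given by the seminorms `X ↦ φ(X⋆ X)^(1/2)` with `φ`
  positive and locally normal. -/
  continuous_action : ∀ φ : A →ₗ[ℂ] ℂ, IsPositiveFunctional φ → IsLocallyNormal regions alg φ →
    ∀ (X : A) (g₀ : Poincare),
      Tendsto (fun g => φ (star (α g X - α g₀ X) * (α g X - α g₀ X))) (𝓝 g₀) (𝓝 0)

namespace LocalNet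

variable {A : Type u} [CStarAlgebra A] (𝔄 : LocalNet A)
  {H : Type v} [NormedAddCommGroup H] [InnerProductSpace ℂ H] [CompleteSpace H]

/-- The `C⋆`-algebra `A(O')` generated by the local algebras of regions in the causal complement
of `O`. -/
def complAlg (O : Set M4) : StarSubalgebra ℂ A :=
  (StarAlgebra.adjoin ℂ (⋃ O₁ ∈ {O₁ ∈ 𝔄.regions | O₁ ⊆ causalComplement O},
    (𝔄.alg O₁ : Set A))).topologicalClosure

/-- Pairs `Λ = (O₁, O₂)` of regions such that the closure of `O₁` is properly contained in `O₂`. -/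
def inclusionPairs : Set (Set M4 × Set M4) :=
  {Λ | Λ.1 ∈ 𝔄.regions ∧ Λ.2 ∈ 𝔄.regions ∧ closure Λ.1 ⊂ Λ.2}

/-- Inclusion pairs of double cones. -/
def doubleConePairs : Set (Set M4 × Set M4) :=
  {Λ | Λ ∈ 𝔄.inclusionPairs ∧ IsDoubleCone Λ.1 ∧ IsDoubleCone Λ.2}

/-- Property B: nonzero projections of the inner algebra are equivalent to `1` in the outer one. -/
def PropertyB : Prop :=
  ∀ Λ ∈ 𝔄.inclusionPairs, ∀ E ∈ 𝔄.alg Λ.1, IsStarProjection E → E ≠ 0 →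
    ∃ W ∈ 𝔄.alg Λ.2, star W * W = 1 ∧ W * star W = E

/-- The dual `π^d(O) = π(A(O'))'` of the net in a representation. -/
def dual (π : A →⋆ₐ[ℂ] (H →L[ℂ] H)) (O : Set M4) : Set (H →L[ℂ] H) :=
  centralizer (π '' (𝔄.complAlg O : Set A))

/-- Haag duality: `π(A(O'))' = π(A(O))''` for all double cones. -/
def HaagDuality (π : A →⋆ₐ[ℂ] (H →L[ℂ] H)) : Prop :=
  ∀ O, IsDoubleCone O → 𝔄.dual π O = centralizer (centralizer (π '' (𝔄.alg O : Set A)))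

/-- Property DHR of a representation. -/
def PropertyDHR (π : A →⋆ₐ[ℂ] (H →L[ℂ] H)) : Prop :=
  ∀ Λ ∈ 𝔄.doubleConePairs, ∀ E ∈ 𝔄.dual π Λ.1, IsStarProjection E → E ≠ 0 →
    ∃ W ∈ 𝔄.dual π Λ.2, star W * W = 1 ∧ W * star W = E

/-- `ω` is a vacuum state with GNS representation `(π, H, Ω)`: a locally normal Poincare invariant
state whose GNS representation is irreducible and carries a strongly continuous unitary
representation `U` of the universal covering group `ℝ⁴ ⋊ SL(2, ℂ)`, fixing `Ω` and implementing the
action; `Ω` is cyclic and separating for every local algebra; and the joint spectrum of the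
generators of the translations lies in the closed forward cone. The last condition is expressed by
the spectral measures of vectors: `⟪ψ, U(a) ψ⟫ = ∫ exp(i p·a) dμ_ψ(p)` with `μ_ψ` carried by the
closed forward cone. -/
structure IsVacuum (ω : A →ₗ[ℂ] ℂ) (π : A →⋆ₐ[ℂ] (H →L[ℂ] H)) (Ω : H) : Prop where
  isState : IsState ω
  locallyNormal : IsLocallyNormal 𝔄.regions 𝔄.alg ω
  invariant : ∀ (g : Poincare) (X : A), ω (𝔄.α g X) = ω X
  gns : ∀ X, ω X = ⟪Ω, π X Ω⟫_ℂ
  gns_cyclic : Dense (range fun X => π X Ω)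
  irreducible : ∀ Y ∈ centralizer (range π), ∃ c : ℂ, Y = c • (1 : H →L[ℂ] H)
  cyclic : ∀ O ∈ 𝔄.regions, Dense ((fun X => π X Ω) '' (𝔄.alg O : Set A))
  separating : ∀ O ∈ 𝔄.regions, ∀ X ∈ 𝔄.alg O, π X Ω = 0 → π X = 0
  exists_unitary_rep : ∃ U : M4 → Matrix.SpecialLinearGroup (Fin 2) ℂ → unitary (H →L[ℂ] H),
    (∀ a b S T, U (a + spinAct S b) (S * T) = U a S * U b T) ∧
    (∀ ψ : H, Continuous fun p : M4 × Matrix.SpecialLinearGroup (Fin 2) ℂ =>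
      (U p.1 p.2 : H →L[ℂ] H) ψ) ∧
    (∀ a S, (U a S : H →L[ℂ] H) Ω = Ω) ∧
    (∀ a S (g : Poincare), LiesOver a S g → ∀ X,
      π (𝔄.α g X) = (U a S : H →L[ℂ] H) * π X * star (U a S : H →L[ℂ] H)) ∧
    ∀ ψ : H, ∃ μ : Measure M4, IsFiniteMeasure μ ∧ μ closedForwardConeᶜ = 0 ∧
      ∀ a, ⟪ψ, (U a 1 : H →L[ℂ] H) ψ⟫_ℂ = ∫ p, Complex.exp (Complex.I * (mink p a : ℂ)) ∂μ

/-- Local states with inclusion pair `Λ`: unital completely positive maps `T` on `A` with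
`T(AB) = T(A)B` for `B ∈ A(O₂')` which are given on `A(O₁)` by a normal state. -/
def IsLocalState [PartialOrder A] [StarOrderedRing A] (Λ : Set M4 × Set M4) (T : A →CP A) : Prop :=
  T 1 = 1 ∧ (∀ X, ∀ B ∈ 𝔄.complAlg Λ.2, T (X * B) = T X * B) ∧
  ∃ φ : 𝔄.alg Λ.1 →ₗ[ℂ] ℂ, IsState φ ∧ IsNormalFunctional φ ∧
    ∀ X : 𝔄.alg Λ.1, T (X : A) = φ X • (1 : A)

/-- A star endomorphism of `π(A)` is localized with support in `O` if it is the identity on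
`π(A(O'))`. -/
def IsLocalized (π : A →⋆ₐ[ℂ] (H →L[ℂ] H)) (O : Set M4) (ρ : π.range →⋆ₐ[ℂ] π.range) : Prop :=
  ∀ X ∈ 𝔄.complAlg O, ρ (π.rangeRestrict X) = π.rangeRestrict X

/-- A localized endomorphism with support in `O` is transportable if, for every `a`, it is of the
form `Ad U ∘ ρ'` with `ρ'` localized in `O + a` and `U` a unitary of `π(A)''`. -/
def IsTransportable (π : A →⋆ₐ[ℂ] (H →L[ℂ] H)) (O : Set M4) (ρ : π.range →⋆ₐ[ℂ] π.range) : Prop :=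
  ∀ a : M4, ∃ ρ' : π.range →⋆ₐ[ℂ] π.range, 𝔄.IsLocalized π (translateRegion a O) ρ' ∧
    ∃ U ∈ unitary (H →L[ℂ] H), U ∈ centralizer (centralizer (range π)) ∧
      ∀ X : π.range, (ρ X : H →L[ℂ] H) = U * (ρ' X : H →L[ℂ] H) * star U

/-- The representation `ρ ∘ π` of `A`. -/
def endoRep (π : A →⋆ₐ[ℂ] (H →L[ℂ] H)) (ρ : π.range →⋆ₐ[ℂ] π.range) : A →⋆ₐ[ℂ] (H →L[ℂ] H) :=
  π.range.subtype.comp (ρ.comp π.rangeRestrict)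

/-- `ρ` is a localized endomorphism with support in `O` that corresponds to `T`:
for some `V ∈ π^d(O)`, `(ρ ∘ π, V)` is a minimal Stinespring representation of `π ∘ T`; in
particular `π (T X) = V⋆ ρ(π X) V`. -/
def Corresponds [PartialOrder A] [StarOrderedRing A] (π : A →⋆ₐ[ℂ] (H →L[ℂ] H)) (O : Set M4)
    (T : A →CP A) (ρ : π.range →⋆ₐ[ℂ] π.range) : Prop :=
  𝔄.IsLocalized π O ρ ∧
    ∃ V ∈ 𝔄.dual π O, IsMinimalStinespring (fun X => π (T X)) (endoRep π ρ) V

/-- The localized endomorphisms corresponding to a local state `T` with outer region `O₂` are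
transportable. All corresponding localized endomorphisms with support in a double cone that
contains `O₂` are meant; their existence is not part of the condition, and any two of them are
unitarily equivalent. -/
def HasTransportableEndomorphisms [PartialOrder A] [StarOrderedRing A]
    (π : A →⋆ₐ[ℂ] (H →L[ℂ] H)) (O₂ : Set M4) (T : A →CP A) : Prop :=
  ∀ O, IsDoubleCone O → O₂ ⊆ O → ∀ ρ : π.range →⋆ₐ[ℂ] π.range,
    𝔄.Corresponds π O T ρ → 𝔄.IsTransportable π O ρ

end LocalNet

end

/-! The principle is that charges can be moved to spacelike infinity. On observables far from where
the charge has been moved, a local state with transportable endomorphisms has the form `π₀ (T X) =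
W⋆ π₀ X W`. So it suffices to choose implementers `W₁`, `W₂` that commute and reach every given `X`.

The algebraic half produces `W`. The Stinespring isometry `V` of `π₀ ∘ T` intertwines on `A(O₂')`,
because `T` fixes that algebra. Hence `V V⋆` lies in the dual of the Stinespring representation, and
property DHR gives `W'` there with `W'⋆ W' = 1` and `W' W'⋆ = V V⋆`. The unitary `W'⋆ V` carries the
representation to the vacuum space, where it becomes a localized endomorphism `ρ` corresponding to
`T` (`exists_corresponds`). Transportability then replaces `ρ` by an endomorphism localized far
away, up to a unitary. This uses that `π₀` is isometric and that `π₀(A(O))` is its own double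
commutant. Local normality and cyclicity of the vacuum give the second; they also reduce the first
to the vanishing of a projection, which property B forces. With Haag duality, operators in `π₀^d(R)`
then come from `A(R)` itself.

The geometric half (`exists_translation`) separates the two regions by a wedge with null directions
`l`, `m` and moves them apart by `± t (l - m)`. Each region and its translate fit into one double
cone, and the two enclosing cones `Q`, `Q'` are still causally separated, so Haag duality makes
`W₁`, `W₂` commute. For large `t` both translates are spacelike to a given large double cone `R`,
and `T₁`, `T₂` map `A(R)` into itself. The identity then holds on `A(R)`, and density and continuity
extend it to all of `A`. -/

/-! ### Light rays and double cones -/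

/-- The future null vectors with time component `1`. -/
def lightRays : Set M4 := {l | l 0 = 1 ∧ l 1 ^ 2 + l 2 ^ 2 + l 3 ^ 2 = 1}

/-- The open double cone with tips `p` and `q`. -/
def doubleCone (p q : M4) : Set M4 := {x | x - p ∈ forwardCone ∧ q - x ∈ forwardCone}

/-- The unit vector in the time direction. -/
def timeVec : M4 := ![1, 0, 0, 0]

theorem mink_add_left (x y z : M4) : mink (x + y) z = mink x z + mink y z := by
  simp only [mink, Pi.add_apply]; ring

theorem mink_sub_left (x y z : M4) : mink (x - y) z = mink x z - mink y z := by
  simp only [mink, Pi.sub_apply]; ring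

theorem mink_neg_left (x z : M4) : mink (-x) z = -mink x z := by
  simp only [mink, Pi.neg_apply]; ring

theorem mink_smul_left (c : ℝ) (x z : M4) : mink (c • x) z = c * mink x z := by
  simp only [mink, Pi.smul_apply, smul_eq_mul]; ring

theorem mink_comm (x y : M4) : mink x y = mink y x := by
  simp only [mink]; ring

theorem mink_timeVec {l : M4} (hl : l ∈ lightRays) : mink timeVec l = 1 := by
  simp [mink, timeVec, hl.1]

theorem mink_self_of_mem_lightRays {l : M4} (hl : l ∈ lightRays) : mink l l = 0 := by
  obtain ⟨h0, h⟩ := hl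
  simp only [mink, h0]; linarith

theorem sq_inner_le_of_mem_lightRays {l : M4} (hl : l ∈ lightRays) (x : M4) :
    (x 1 * l 1 + x 2 * l 2 + x 3 * l 3) ^ 2 ≤ x 1 ^ 2 + x 2 ^ 2 + x 3 ^ 2 := by
  have h := hl.2
  have key : (x 1 * l 1 + x 2 * l 2 + x 3 * l 3) ^ 2 ≤
      (x 1 ^ 2 + x 2 ^ 2 + x 3 ^ 2) * (l 1 ^ 2 + l 2 ^ 2 + l 3 ^ 2) := by
    nlinarith [sq_nonneg (x 1 * l 2 - x 2 * l 1), sq_nonneg (x 1 * l 3 - x 3 * l 1),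
      sq_nonneg (x 2 * l 3 - x 3 * l 2)]
  rwa [h, mul_one] at key

/-- The minimum of `mink x` over the light rays is attained at the ray pointing along the spatial
part of `x`; when that part vanishes any ray will do. -/
theorem exists_lightRay_mink_eq (x : M4) :
    ∃ l ∈ lightRays, mink x l = x 0 - √(x 1 ^ 2 + x 2 ^ 2 + x 3 ^ 2) := by
  set s := √(x 1 ^ 2 + x 2 ^ 2 + x 3 ^ 2) with hs
  have hss : s ^ 2 = x 1 ^ 2 + x 2 ^ 2 + x 3 ^ 2 := Real.sq_sqrt (by positivity)
  by_cases h : s = 0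
  · refine ⟨![1, 1, 0, 0], ⟨by simp, by simp⟩, ?_⟩
    rw [h] at hss
    have h1 : x 1 = 0 := by
      have : x 1 ^ 2 = 0 := by nlinarith [sq_nonneg (x 1), sq_nonneg (x 2), sq_nonneg (x 3)]
      simpa using this
    simp [mink, h, h1]
  · refine ⟨![1, x 1 / s, x 2 / s, x 3 / s], ⟨by simp, ?_⟩, ?_⟩
    · simp only [Matrix.cons_val]
      field_simp
      exact hss.symm
    · simp only [mink, Matrix.cons_val]
      field_simp
      linarith

/-- The cone is self-dual and its dual is generated by light rays. This replaces the quadratic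
condition by linear ones, so that later inclusions and separations reduce to linear arithmetic. -/
theorem mem_forwardCone_iff {x : M4} : x ∈ forwardCone ↔ ∀ l ∈ lightRays, 0 < mink x l := by
  constructor
  · rintro ⟨h1, h2⟩ l hl
    have h := sq_inner_le_of_mem_lightRays hl x
    have h3 : x 1 * l 1 + x 2 * l 2 + x 3 * l 3 < x 0 := by
      refine lt_of_pow_lt_pow_left₀ 2 h2.le ?_
      simp only [mink] at h1
      nlinarith
    simp only [mink, hl.1]
    linarith
  · intro h
    obtain ⟨l, hl, hxl⟩ := exists_lightRay_mink_eq x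
    have h1 := h l hl
    rw [hxl] at h1
    have h2 := Real.sqrt_nonneg (x 1 ^ 2 + x 2 ^ 2 + x 3 ^ 2)
    have h3 : √(x 1 ^ 2 + x 2 ^ 2 + x 3 ^ 2) ^ 2 = x 1 ^ 2 + x 2 ^ 2 + x 3 ^ 2 :=
      Real.sq_sqrt (by positivity)
    refine ⟨?_, by linarith⟩
    simp only [mink]
    nlinarith

theorem mem_closedForwardCone_iff {x : M4} :
    x ∈ closedForwardCone ↔ ∀ l ∈ lightRays, 0 ≤ mink x l := by
  constructor
  · rintro ⟨h1, h2⟩ l hl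
    have h := sq_inner_le_of_mem_lightRays hl x
    have h3 : x 1 * l 1 + x 2 * l 2 + x 3 * l 3 ≤ x 0 := by
      refine le_of_sq_le_sq ?_ h2
      simp only [mink] at h1
      nlinarith
    simp only [mink, hl.1]
    linarith
  · intro h
    obtain ⟨l, hl, hxl⟩ := exists_lightRay_mink_eq x
    have h1 := h l hl
    rw [hxl] at h1
    have h2 := Real.sqrt_nonneg (x 1 ^ 2 + x 2 ^ 2 + x 3 ^ 2)
    have h3 : √(x 1 ^ 2 + x 2 ^ 2 + x 3 ^ 2) ^ 2 = x 1 ^ 2 + x 2 ^ 2 + x 3 ^ 2 :=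
      Real.sq_sqrt (by positivity)
    refine ⟨?_, by linarith⟩
    simp only [mink]
    nlinarith

theorem forwardCone_subset_closedForwardCone : forwardCone ⊆ closedForwardCone :=
  fun _ hx => ⟨hx.1.le, hx.2.le⟩

theorem lightRays_subset_closedForwardCone : lightRays ⊆ closedForwardCone :=
  fun l hl => ⟨(mink_self_of_mem_lightRays hl).ge, by rw [hl.1]; exact zero_le_one⟩

theorem add_mem_forwardCone {x y : M4} (hx : x ∈ forwardCone) (hy : y ∈ closedForwardCone) :
    x + y ∈ forwardCone := by
  rw [mem_forwardCone_iff] at *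
  rw [mem_closedForwardCone_iff] at hy
  intro l hl
  rw [mink_add_left]
  exact add_pos_of_pos_of_nonneg (hx l hl) (hy l hl)

theorem smul_mem_forwardCone {c : ℝ} (hc : 0 < c) {x : M4} (hx : x ∈ forwardCone) :
    c • x ∈ forwardCone := by
  rw [mem_forwardCone_iff] at *
  intro l hl
  rw [mink_smul_left]
  exact mul_pos hc (hx l hl)

theorem smul_mem_closedForwardCone {c : ℝ} (hc : 0 ≤ c) {x : M4} (hx : x ∈ closedForwardCone) :
    c • x ∈ closedForwardCone := by
  rw [mem_closedForwardCone_iff] at *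
  intro l hl
  rw [mink_smul_left]
  exact mul_nonneg hc (hx l hl)

theorem timeVec_mem_forwardCone : timeVec ∈ forwardCone :=
  mem_forwardCone_iff.2 fun l hl => by rw [mink_timeVec hl]; exact zero_lt_one

theorem continuous_mink_self : Continuous fun x : M4 => mink x x := by
  unfold mink; fun_prop

theorem isOpen_forwardCone : IsOpen forwardCone :=
  (isOpen_lt continuous_const continuous_mink_self).inter
    (isOpen_lt continuous_const (continuous_apply 0))

theorem isClosed_closedForwardCone : IsClosed closedForwardCone :=
  (isClosed_le continuous_const continuous_mink_self).inter
    (isClosed_le continuous_const (continuous_apply 0))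

theorem isDoubleCone_doubleCone {p q : M4} (h : q - p ∈ forwardCone) :
    IsDoubleCone (doubleCone p q) := ⟨p, q, h, rfl⟩

theorem doubleCone_subset {p q p' q' : M4} (hp : p - p' ∈ closedForwardCone)
    (hq : q' - q ∈ closedForwardCone) : doubleCone p q ⊆ doubleCone p' q' := by
  rintro x ⟨h1, h2⟩
  refine ⟨?_, ?_⟩
  · have := add_mem_forwardCone h1 hp
    rwa [sub_add_sub_cancel] at this
  · have := add_mem_forwardCone h2 hq
    rwa [sub_add_sub_cancel'] at this

theorem translateRegion_doubleCone (a p q : M4) :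
    translateRegion a (doubleCone p q) = doubleCone (p + a) (q + a) := by
  ext x
  simp only [translateRegion, doubleCone, mem_image, mem_ofPred_eq]
  constructor
  · rintro ⟨y, ⟨h1, h2⟩, rfl⟩
    rw [add_sub_add_right_eq_sub, add_sub_add_right_eq_sub]
    exact ⟨h1, h2⟩
  · rintro ⟨h1, h2⟩
    refine ⟨x - a, ⟨?_, ?_⟩, sub_add_cancel x a⟩
    · rwa [sub_sub, add_comm a p]
    · rwa [sub_sub_eq_add_sub]

theorem closure_doubleCone_ssubset {p q : M4} (h : q - p ∈ forwardCone) :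
    closure (doubleCone p q) ⊂ doubleCone (p - timeVec) (q + timeVec) := by
  have hcl : closure (doubleCone p q) ⊆ {x | x - p ∈ closedForwardCone ∧
      q - x ∈ closedForwardCone} := by
    refine closure_minimal (fun x hx => ⟨forwardCone_subset_closedForwardCone hx.1,
      forwardCone_subset_closedForwardCone hx.2⟩) ?_
    exact (isClosed_closedForwardCone.preimage (by fun_prop : Continuous fun x : M4 => x - p)).inter
      (isClosed_closedForwardCone.preimage (by fun_prop : Continuous fun x : M4 => q - x))
  have ht := timeVec_mem_forwardCone
  refine ssubset_of_subset_of_ne (fun x hx => ?_) fun heq => ?_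
  · obtain ⟨h1, h2⟩ := hcl hx
    refine ⟨?_, ?_⟩
    · convert add_mem_forwardCone ht h1 using 1; abel
    · convert add_mem_forwardCone ht h2 using 1; abel
  -- Properness: a point strictly later than the tip `q` lies in the larger cone but not in the
  -- closure of the smaller one.
  · have hx : q + (1 / 2 : ℝ) • timeVec ∈ doubleCone (p - timeVec) (q + timeVec) := by
      refine ⟨?_, ?_⟩
      · convert add_mem_forwardCone h (forwardCone_subset_closedForwardCone
          (smul_mem_forwardCone (show (0 : ℝ) < 3 / 2 by norm_num) ht)) using 1
        module
      · convert smul_mem_forwardCone (show (0 : ℝ) < 1 / 2 by norm_num) ht using 1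
        module
    rw [← heq] at hx
    have h0 : (0 : ℝ) ≤ (q - (q + (1 / 2 : ℝ) • timeVec)) 0 := (hcl hx).2.2
    simp only [timeVec, Pi.sub_apply, Pi.add_apply, Pi.smul_apply, smul_eq_mul,
      Matrix.cons_val] at h0
    linarith

theorem exists_subset_doubleCone {s : Set M4} (hs : Bornology.IsBounded s) :
    ∃ r₀ : ℝ, ∀ r, r₀ ≤ r → s ⊆ doubleCone (-(r • timeVec)) (r • timeVec) := by
  obtain ⟨M, hM⟩ := hs.exists_norm_le
  -- Each of the four terms of `mink x l` is at most `M` in absolute value; the extra `1` makes the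
  -- inequalities strict.
  refine ⟨4 * M + 1, fun r hr x hx => ?_⟩
  have hb : ∀ l ∈ lightRays, |mink x l| ≤ 4 * M := by
    intro l hl
    have hx' : ∀ i, |x i| ≤ M := fun i => (norm_le_pi_norm x i).trans (hM x hx)
    have hM0 : 0 ≤ M := (abs_nonneg _).trans (hx' 0)
    obtain ⟨h0, h⟩ := hl
    have hl1 : |l 1| ≤ 1 := abs_le_one_iff_mul_self_le_one.2 (by
      nlinarith [sq_nonneg (l 2), sq_nonneg (l 3)])
    have hl2 : |l 2| ≤ 1 := abs_le_one_iff_mul_self_le_one.2 (by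
      nlinarith [sq_nonneg (l 1), sq_nonneg (l 3)])
    have hl3 : |l 3| ≤ 1 := abs_le_one_iff_mul_self_le_one.2 (by
      nlinarith [sq_nonneg (l 1), sq_nonneg (l 2)])
    have hmul : ∀ {a b : ℝ}, |a| ≤ M → |b| ≤ 1 → |a * b| ≤ M := fun {a b} ha hb' => by
      rw [abs_mul]; nlinarith [abs_nonneg a, abs_nonneg b]
    have e0 := abs_le.1 (hx' 0)
    have e1 := abs_le.1 (hmul (hx' 1) hl1)
    have e2 := abs_le.1 (hmul (hx' 2) hl2)
    have e3 := abs_le.1 (hmul (hx' 3) hl3)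
    simp only [mink, h0, mul_one]
    exact abs_le.2 ⟨by linarith, by linarith⟩
  refine ⟨mem_forwardCone_iff.2 fun l hl => ?_, mem_forwardCone_iff.2 fun l hl => ?_⟩
  · have := abs_le.1 (hb l hl)
    rw [mink_sub_left, mink_neg_left, mink_smul_left, mink_timeVec hl]
    linarith
  · have := abs_le.1 (hb l hl)
    rw [mink_sub_left, mink_smul_left, mink_timeVec hl]
    linarith

/-! ### Separation of double cones by wedges -/

theorem mink_sub_self_comm (x y : M4) : mink (x - y) (x - y) = mink (y - x) (y - x) := by
  simp only [mink, Pi.sub_apply]; ring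

theorem CausallySeparated.symm {O₁ O₂ : Set M4} (h : CausallySeparated O₁ O₂) :
    CausallySeparated O₂ O₁ := fun y hy x hx => by
  rw [mink_sub_self_comm]; exact h hx y hy

/-- Double cones separated by a wedge are causally separated. -/
theorem causallySeparated_of_wedge {p q p' q' l m : M4} (hl : l ∈ lightRays) (hm : m ∈ lightRays)
    (h1 : mink (q - p') l ≤ 0) (h2 : 0 ≤ mink (p - q') m) :
    CausallySeparated (doubleCone p q) (doubleCone p' q') := by
  rintro x ⟨hx1, hx2⟩ y ⟨hy1, hy2⟩
  rw [mem_forwardCone_iff] at hx1 hx2 hy1 hy2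
  have a1 := hx2 l hl
  have a2 := hy1 l hl
  have a3 := hx1 m hm
  have a4 := hy2 m hm
  rw [mink_sub_left] at h1 h2 a1 a2 a3 a4
  -- A difference that is not spacelike is nonnegative on all light rays, up to an overall sign: `l`
  -- excludes the future case, `m` the past case.
  by_contra hneg
  rw [not_lt] at hneg
  rcases le_total 0 ((x - y) 0) with h0 | h0
  · have := mem_closedForwardCone_iff.1 (⟨hneg, h0⟩ : x - y ∈ closedForwardCone) l hl
    rw [mink_sub_left] at this
    linarith
  · have hneg' : 0 ≤ mink (y - x) (y - x) := by rwa [mink_sub_self_comm]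
    have h0' : 0 ≤ (y - x) 0 := by simp only [Pi.sub_apply] at *; linarith
    have := mem_closedForwardCone_iff.1 (⟨hneg', h0'⟩ : y - x ∈ closedForwardCone) m hm
    rw [mink_sub_left] at this
    linarith

/-- The tips are only limit points of the open cones. Since the forward cone is open, a timelike `q
- p'` would stay timelike after moving slightly inwards from `q` and `p'`, giving a timelike pair of
interior points. -/
theorem CausallySeparated.sub_notMem_forwardCone {p q p' q' : M4} (h : q - p ∈ forwardCone)
    (h' : q' - p' ∈ forwardCone)
    (hsep : CausallySeparated (doubleCone p q) (doubleCone p' q')) :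
    q - p' ∉ forwardCone := by
  intro hmem
  have hc : Continuous fun t : ℝ => (q - p') - t • ((q - p) + (q' - p')) := by fun_prop
  have hev : ∀ᶠ t in 𝓝[>] (0 : ℝ), (q - p') - t • ((q - p) + (q' - p')) ∈ forwardCone := by
    refine (hc.continuousAt.eventually ?_).filter_mono nhdsWithin_le_nhds
    simp only [zero_smul, sub_zero]
    exact isOpen_forwardCone.mem_nhds hmem
  have hlt : ∀ᶠ t in 𝓝[>] (0 : ℝ), t < 1 :=
    (eventually_lt_nhds zero_lt_one).filter_mono nhdsWithin_le_nhds
  obtain ⟨t, ht, ht1, ht0⟩ := (hev.and (hlt.and self_mem_nhdsWithin)).exists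
  have ht0' : 0 < t := ht0
  have ht1' : 0 < 1 - t := sub_pos.2 ht1
  have hx : q - t • (q - p) ∈ doubleCone p q := by
    refine ⟨?_, ?_⟩
    · convert smul_mem_forwardCone ht1' h using 1; module
    · convert smul_mem_forwardCone ht0' h using 1; module
  have hy : p' + t • (q' - p') ∈ doubleCone p' q' := by
    refine ⟨?_, ?_⟩
    · convert smul_mem_forwardCone ht0' h' using 1; module
    · convert smul_mem_forwardCone ht1' h' using 1; module
  have := hsep hx _ hy
  have h2 := ht.1
  rw [show q - p' - t • (q - p + (q' - p')) = q - t • (q - p) - (p' + t • (q' - p')) by module]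
    at h2
  exact lt_asymm this h2

theorem exists_lightRay_mink_nonpos {x : M4} (hx : x ∉ forwardCone) :
    ∃ l ∈ lightRays, mink x l ≤ 0 := by
  rw [mem_forwardCone_iff] at hx
  push Not at hx
  exact hx

/-- For two light rays, `mink l m` is half the squared distance of their spatial directions. -/
theorem mink_lightRays_pos {l m : M4} (hl : l ∈ lightRays) (hm : m ∈ lightRays) (hne : l ≠ m) :
    0 < mink l m := by
  obtain ⟨l0, h⟩ := hl
  obtain ⟨m0, h'⟩ := hm
  have hkey : mink l m = ((l 1 - m 1) ^ 2 + (l 2 - m 2) ^ 2 + (l 3 - m 3) ^ 2) / 2 := by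
    simp only [mink, l0, m0]; linarith
  rw [hkey]
  refine lt_of_le_of_ne (by positivity) fun h0 => hne ?_
  have e1 : l 1 - m 1 = 0 := by
    nlinarith [sq_nonneg (l 1 - m 1), sq_nonneg (l 2 - m 2), sq_nonneg (l 3 - m 3)]
  have e2 : l 2 - m 2 = 0 := by
    nlinarith [sq_nonneg (l 1 - m 1), sq_nonneg (l 2 - m 2), sq_nonneg (l 3 - m 3)]
  have e3 : l 3 - m 3 = 0 := by
    nlinarith [sq_nonneg (l 1 - m 1), sq_nonneg (l 2 - m 2), sq_nonneg (l 3 - m 3)]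
  ext i
  fin_cases i
  · simp [l0, m0]
  · simpa using sub_eq_zero.1 e1
  · simpa using sub_eq_zero.1 e2
  · simpa using sub_eq_zero.1 e3

/-- Causally separated double cones are separated by a wedge. -/
theorem CausallySeparated.exists_wedge {p q p' q' : M4} (h : q - p ∈ forwardCone)
    (h' : q' - p' ∈ forwardCone)
    (hsep : CausallySeparated (doubleCone p q) (doubleCone p' q')) :
    ∃ l ∈ lightRays, ∃ m ∈ lightRays, 0 < mink l m ∧ mink (q - p') l ≤ 0 ∧
      0 ≤ mink (p - q') m := by
  obtain ⟨l, hl, h1⟩ := exists_lightRay_mink_nonpos (hsep.sub_notMem_forwardCone h h')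
  obtain ⟨m, hm, h2⟩ := exists_lightRay_mink_nonpos (hsep.symm.sub_notMem_forwardCone h' h)
  refine ⟨l, hl, m, hm, mink_lightRays_pos hl hm ?_, h1, ?_⟩
  -- If both inequalities held for the same ray, the heights along it would satisfy `q ≤ p' < q' ≤ p
  -- < q`.
  · rintro rfl
    have a1 := mem_forwardCone_iff.1 h l hl
    have a2 := mem_forwardCone_iff.1 h' l hl
    simp only [mink_sub_left] at *
    linarith
  · simp only [mink_sub_left] at *
    linarith

/-- Two causally separated double cones can be moved far apart inside causally separated
double cones. -/
theorem CausallySeparated.exists_translation {p q p' q' : M4} (h : q - p ∈ forwardCone)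
    (h' : q' - p' ∈ forwardCone)
    (hsep : CausallySeparated (doubleCone p q) (doubleCone p' q')) (r : ℝ) :
    ∃ (a : M4) (Q Q' : Set M4), IsDoubleCone Q ∧ IsDoubleCone Q' ∧ CausallySeparated Q Q' ∧
      doubleCone p q ⊆ Q ∧ doubleCone p' q' ⊆ Q' ∧
      translateRegion a (doubleCone (p - timeVec) (q + timeVec)) ⊆ Q ∧
      translateRegion (-a) (doubleCone (p' - timeVec) (q' + timeVec)) ⊆ Q' ∧
      CausallySeparated (doubleCone (-(r • timeVec)) (r • timeVec))
        (translateRegion a (doubleCone (p - timeVec) (q + timeVec))) ∧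
      CausallySeparated (doubleCone (-(r • timeVec)) (r • timeVec))
        (translateRegion (-a) (doubleCone (p' - timeVec) (q' + timeVec))) := by
  obtain ⟨l, hl, m, hm, hc, h1, h2⟩ := hsep.exists_wedge h h'
  -- The first pair of bounds places the enlarged translates inside `Q` and `Q'`; the other two
  -- pairs separate the first and the second translate from the cone of radius `r`.
  have hev : ∀ᶠ t in atTop, (1 ≤ t ∧ 2 ≤ t * mink l m) ∧
      (mink q l + 1 + r ≤ t * mink l m ∧ 1 + r - mink p m ≤ t * mink l m) ∧
      (1 + r - mink p' l ≤ t * mink l m ∧ mink q' m + 1 + r ≤ t * mink l m) := by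
    have ht : Tendsto (fun t : ℝ => t * mink l m) atTop atTop := tendsto_id.atTop_mul_const hc
    exact ((eventually_ge_atTop 1).and (ht.eventually_ge_atTop _)).and
      (((ht.eventually_ge_atTop _).and (ht.eventually_ge_atTop _)).and
      ((ht.eventually_ge_atTop _).and (ht.eventually_ge_atTop _)))
  obtain ⟨t, ⟨ht1, ht2⟩, ⟨ht3, ht4⟩, ht5, ht6⟩ := hev.exists
  have hl' := lightRays_subset_closedForwardCone hl
  have hm' := lightRays_subset_closedForwardCone hm
  have ht0 : 0 ≤ 2 * t := by linarith
  -- The form of this vector is `2 t (t (l·m) - 2) + 1`, hence nonnegative. The vector is the gap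
  -- between corresponding tips of a translate and of its enclosing cone.
  have hlm : t • (l + m) - timeVec ∈ closedForwardCone := by
    have l0 := hl.1
    have m0 := hm.1
    have hll := mink_self_of_mem_lightRays hl
    have hmm := mink_self_of_mem_lightRays hm
    refine ⟨?_, ?_⟩
    · have : mink (t • (l + m) - timeVec) (t • (l + m) - timeVec)
          = t ^ 2 * (mink l l + 2 * mink l m + mink m m) - 2 * t * (l 0 + m 0) + 1 := by
        simp only [mink, timeVec, Pi.sub_apply, Pi.smul_apply, Pi.add_apply, smul_eq_mul,
          Matrix.cons_val]
        ring
      rw [this, hll, hmm, l0, m0]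
      nlinarith
    · simp only [timeVec, Pi.sub_apply, Pi.smul_apply, Pi.add_apply, smul_eq_mul,
        Matrix.cons_val, l0, m0]
      linarith
  have hll := mink_self_of_mem_lightRays hl
  have hmm := mink_self_of_mem_lightRays hm
  have hml : mink m l = mink l m := mink_comm m l
  have htl := mink_timeVec hl
  have htm := mink_timeVec hm
  -- Because `l` and `m` are null, stretching the tips along them leaves the two wedge inequalities
  -- unchanged, so the enlarged cones remain separated.
  refine ⟨t • (l - m), doubleCone (p - (2 * t) • m) (q + (2 * t) • l),
    doubleCone (p' - (2 * t) • l) (q' + (2 * t) • m), isDoubleCone_doubleCone ?_,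
    isDoubleCone_doubleCone ?_, causallySeparated_of_wedge hl hm ?_ ?_,
    doubleCone_subset ?_ ?_, doubleCone_subset ?_ ?_, ?_, ?_, ?_, ?_⟩
  · convert add_mem_forwardCone (add_mem_forwardCone h (smul_mem_closedForwardCone ht0 hl'))
      (smul_mem_closedForwardCone ht0 hm') using 1
    abel
  · convert add_mem_forwardCone (add_mem_forwardCone h' (smul_mem_closedForwardCone ht0 hl'))
      (smul_mem_closedForwardCone ht0 hm') using 1
    abel
  · simp only [mink_sub_left, mink_add_left, mink_smul_left, hll] at *
    linarith
  · simp only [mink_sub_left, mink_add_left, mink_smul_left, hmm] at *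
    linarith
  · convert smul_mem_closedForwardCone ht0 hm' using 1; abel
  · convert smul_mem_closedForwardCone ht0 hl' using 1; abel
  · convert smul_mem_closedForwardCone ht0 hl' using 1; abel
  · convert smul_mem_closedForwardCone ht0 hm' using 1; abel
  · rw [translateRegion_doubleCone]
    refine doubleCone_subset ?_ ?_
    · convert hlm using 1; module
    · convert hlm using 1; module
  · rw [translateRegion_doubleCone]
    refine doubleCone_subset ?_ ?_
    · convert hlm using 1; module
    · convert hlm using 1; module
  · rw [translateRegion_doubleCone]
    refine CausallySeparated.symm (causallySeparated_of_wedge hl hm ?_ ?_)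
    · simp only [mink_sub_left, mink_add_left, mink_neg_left, mink_smul_left, hll, htl, hml] at *
      linarith
    · simp only [mink_sub_left, mink_add_left, mink_smul_left, hmm, htm] at *
      linarith
  · rw [translateRegion_doubleCone]
    refine causallySeparated_of_wedge hl hm ?_ ?_
    · simp only [mink_sub_left, mink_add_left, mink_neg_left, mink_smul_left, hll, htl, hml] at *
      linarith
    · simp only [mink_sub_left, mink_add_left, mink_neg_left, mink_smul_left, hmm, htm] at *
      linarith

/-! ### Bounded operators determined on total sets -/

section Extension

variable {K : Type*} [NormedAddCommGroup K] [InnerProductSpace ℂ K] [CompleteSpace K]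
  {F : Type*} [NormedAddCommGroup F] [NormedSpace ℂ F]

/-- Two bounded operators agree if they agree on a set and on its orthogonal complement. -/
theorem ContinuousLinearMap.eq_of_eq_on_of_eq_on_orthogonal {f g : K →L[ℂ] F} {D : Set K}
    (h : ∀ d ∈ D, f d = g d) (h' : ∀ k, (∀ d ∈ D, ⟪d, k⟫_ℂ = 0) → f k = g k) : f = g := by
  set N := (Submodule.span ℂ D).topologicalClosure with hN
  have hNc : IsClosed (N : Set K) := Submodule.isClosed_topologicalClosure _
  have : CompleteSpace N := hNc.completeSpace_coe
  have h1 : ∀ k ∈ N, f k = g k := by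
    have : N ≤ (f - g).ker := by
      refine Submodule.topologicalClosure_minimal _ (Submodule.span_le.2 fun d hd => ?_)
        (f - g).isClosed_ker
      simp [h d hd]
    intro k hk
    have := this hk
    simpa [sub_eq_zero] using this
  ext k
  have h2 := h1 _ (N.starProjection_apply_mem k)
  have h3 := h' (k - N.starProjection k) fun d hd => by
    have hd' : d ∈ N := Submodule.le_topologicalClosure _ (Submodule.subset_span hd)
    exact N.sub_starProjection_mem_orthogonal k d hd'
  rw [map_sub, map_sub, h2] at h3
  exact sub_left_injective h3

/-- A linear map that is bounded relative to a map `e` into a Hilbert space factors through `e`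
and a bounded operator which vanishes on the orthogonal complement of the range of `e`. -/
theorem exists_clm_of_norm_le [CompleteSpace F] {E : Type*} [AddCommGroup E] [Module ℂ E]
    (f : E →ₗ[ℂ] F) (e : E →ₗ[ℂ] K) (C : ℝ) (h : ∀ x, ‖f x‖ ≤ C * ‖e x‖) :
    ∃ S : K →L[ℂ] F, (∀ x, S (e x) = f x) ∧ ∀ k, (∀ x, ⟪e x, k⟫_ℂ = 0) → S k = 0 := by
  set N := (LinearMap.range e).topologicalClosure with hN
  have hNc : IsClosed (N : Set K) := Submodule.isClosed_topologicalClosure _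
  have : CompleteSpace N := hNc.completeSpace_coe
  have hmem : ∀ x, e x ∈ N := fun x => Submodule.le_topologicalClosure _ ⟨x, rfl⟩
  let e' : E →ₗ[ℂ] N := e.codRestrict N hmem
  have hd : DenseRange e' := by
    rw [DenseRange, Subtype.dense_iff]
    intro y hy
    have : ((↑) : N → K) '' range e' = LinearMap.range e := by
      ext z
      simp [e']
    exact this ▸ hy
  refine ⟨(f.extendOfNorm e') ∘L N.orthogonalProjectionOnto, fun x => ?_, fun k hk => ?_⟩
  · have : N.orthogonalProjectionOnto (e x) = e' x :=
      Submodule.orthogonalProjectionOnto_mem_subspace_eq_self (e' x)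
    rw [ContinuousLinearMap.comp_apply, this]
    exact LinearMap.extendOfNorm_eq hd ⟨C, h⟩ x
  · have hk' : k ∈ Nᗮ := by
      rw [hN, Submodule.orthogonal_closure]
      rintro _ ⟨x, rfl⟩
      exact hk x
    rw [ContinuousLinearMap.comp_apply,
      Submodule.orthogonalProjectionOnto_apply_of_mem_orthogonal hk', map_zero]

end Extension

/-- The polarization bound, which dominates a functional `⟪x, · y⟫` that is positive by the vector
functional of `x + y`. -/
theorem four_mul_re_inner_le {E : Type*} [NormedAddCommGroup E] [InnerProductSpace ℂ E] (a b : E) :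
    4 * RCLike.re ⟪a, b⟫_ℂ ≤ ‖a + b‖ ^ 2 := by
  have h4 := norm_add_sq (𝕜 := ℂ) a b
  have h5 := norm_sub_sq (𝕜 := ℂ) a b
  nlinarith [sq_nonneg ‖a - b‖]

/-! ### Intertwiners and quasi-contained representations of von Neumann algebras -/

section Intertwiners

variable {M : Type*} [Ring M] [StarRing M] [Algebra ℂ M]
  {L : Type*} [NormedAddCommGroup L] [InnerProductSpace ℂ L] [CompleteSpace L]
  {H : Type*} [NormedAddCommGroup H] [InnerProductSpace ℂ H] [CompleteSpace H]
  {σ : M →⋆ₐ[ℂ] (L →L[ℂ] L)} {π : M →⋆ₐ[ℂ] (H →L[ℂ] H)}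

/-- The bounded intertwiners between two representations. -/
def intertwiners (σ : M →⋆ₐ[ℂ] (L →L[ℂ] L)) (π : M →⋆ₐ[ℂ] (H →L[ℂ] H)) : Set (L →L[ℂ] H) :=
  {s | ∀ X v, s (σ X v) = π X (s v)}

/-- The vectors in the ranges of the adjoints of the intertwiners. -/
def adjointRanges (σ : M →⋆ₐ[ℂ] (L →L[ℂ] L)) (π : M →⋆ₐ[ℂ] (H →L[ℂ] H)) : Set L :=
  {k | ∃ s ∈ intertwiners σ π, ∃ h, s.adjoint h = k}

theorem apply_inner_left (π : M →⋆ₐ[ℂ] (H →L[ℂ] H)) (X : M) (h k : H) :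
    ⟪π X h, k⟫_ℂ = ⟪h, π (star X) k⟫_ℂ := by
  rw [map_star, ContinuousLinearMap.star_eq_adjoint, ContinuousLinearMap.adjoint_inner_right]

theorem adjoint_apply_of_mem_intertwiners {s : L →L[ℂ] H} (hs : s ∈ intertwiners σ π) (X : M)
    (h : H) : s.adjoint (π X h) = σ X (s.adjoint h) := by
  refine ext_inner_left ℂ fun v => ?_
  have h1 := hs (star X) v
  rw [ContinuousLinearMap.adjoint_inner_right, ← star_star X, ← apply_inner_left, ← h1,
    ← apply_inner_left, ContinuousLinearMap.adjoint_inner_right]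

theorem comp_mem_intertwiners {s : L →L[ℂ] H} (hs : s ∈ intertwiners σ π) {T : L →L[ℂ] L}
    (hT : T ∈ centralizer (range σ)) : s ∘L T ∈ intertwiners σ π := by
  intro X v
  have h1 : σ X (T v) = T (σ X v) := congrArg (fun Z : L →L[ℂ] L => Z v) (hT _ ⟨X, rfl⟩)
  rw [ContinuousLinearMap.comp_apply, ← h1, hs, ContinuousLinearMap.comp_apply]

theorem comp_adjoint_mem_centralizer {s t : L →L[ℂ] H} (hs : s ∈ intertwiners σ π)
    (ht : t ∈ intertwiners σ π) : s ∘L t.adjoint ∈ centralizer (range π) := by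
  rintro _ ⟨X, rfl⟩
  ext h
  simp only [mul_apply_eq_comp, ContinuousLinearMap.comp_apply]
  rw [adjoint_apply_of_mem_intertwiners ht, hs]

theorem star_mem_centralizer_range (σ : M →⋆ₐ[ℂ] (L →L[ℂ] L)) {T : L →L[ℂ] L}
    (hT : T ∈ centralizer (range σ)) : star T ∈ centralizer (range σ) := by
  rintro _ ⟨X, rfl⟩
  have h := congrArg star (hT _ ⟨star X, rfl⟩)
  rw [map_star, star_mul, star_mul, star_star] at h
  exact h.symm

theorem apply_mem_adjointRanges {T : L →L[ℂ] L} (hT : T ∈ centralizer (range σ)) {k : L}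
    (hk : k ∈ adjointRanges σ π) : T k ∈ adjointRanges σ π := by
  obtain ⟨s, hs, h, rfl⟩ := hk
  refine ⟨s ∘L star T, comp_mem_intertwiners hs (star_mem_centralizer_range σ hT), h, ?_⟩
  rw [ContinuousLinearMap.adjoint_comp, ContinuousLinearMap.star_eq_adjoint,
    ContinuousLinearMap.adjoint_adjoint, ContinuousLinearMap.comp_apply]

theorem inner_apply_eq_zero_of_orthogonal {T : L →L[ℂ] L} (hT : T ∈ centralizer (range σ)) {k : L}
    (hk : ∀ d ∈ adjointRanges σ π, ⟪d, k⟫_ℂ = 0) : ∀ d ∈ adjointRanges σ π, ⟪d, T k⟫_ℂ = 0 := by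
  intro d hd
  rw [← ContinuousLinearMap.adjoint_inner_left, ← ContinuousLinearMap.star_eq_adjoint]
  exact hk _ (apply_mem_adjointRanges (star_mem_centralizer_range σ hT) hd)

/-- If the intertwiners from a von Neumann algebra are total, the representation annihilates a
projection outside of which it is faithful. -/
theorem exists_isStarProjection_map_eq_zero (hσ : IsVonNeumannRealization σ)
    (htot : ∀ h, (∀ s ∈ intertwiners σ π, s.adjoint h = 0) → h = 0) :
    ∃ p : M, IsStarProjection p ∧ π p = 0 ∧ (p = 0 → Function.Injective π) := by
  set N := (Submodule.span ℂ (adjointRanges σ π)).topologicalClosure with hN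
  have hNc : IsClosed (N : Set L) := Submodule.isClosed_topologicalClosure _
  have : CompleteSpace N := hNc.completeSpace_coe
  have hsub : ∀ d ∈ adjointRanges σ π, N.starProjection d = d := fun d hd =>
    N.starProjection_eq_self_iff.2 (Submodule.le_topologicalClosure _ (Submodule.subset_span hd))
  have horth : ∀ k, (∀ d ∈ adjointRanges σ π, ⟪d, k⟫_ℂ = 0) → N.starProjection k = 0 := by
    intro k hk
    rw [Submodule.starProjection_apply_eq_zero_iff, hN, Submodule.orthogonal_closure]
    intro d hd
    induction hd using Submodule.span_induction with
    | mem d hd => exact hk d hd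
    | zero => exact inner_zero_left _
    | add a b _ _ ha hb => rw [inner_add_left, ha, hb, add_zero]
    | smul c a _ ha => rw [inner_smul_left, ha, mul_zero]
  -- The commutant of `σ` leaves the adjoint ranges, and therefore their orthogonal complement,
  -- invariant. The projection is thus `σ e` for some `e`, and `1 - e` is the required projection.
  have hcc : N.starProjection ∈ centralizer (centralizer (range σ)) := by
    intro T hT
    refine ContinuousLinearMap.eq_of_eq_on_of_eq_on_orthogonal (D := adjointRanges σ π)
      (fun d hd => ?_) fun k hk => ?_
    · simp only [mul_apply_eq_comp]
      rw [hsub d hd, hsub _ (apply_mem_adjointRanges hT hd)]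
    · simp only [mul_apply_eq_comp]
      rw [horth k hk, horth _ (inner_apply_eq_zero_of_orthogonal hT hk), map_zero]
  rw [hσ.2] at hcc
  obtain ⟨e, he⟩ := hcc
  have hproj : IsStarProjection e := by
    have h : IsStarProjection (σ e) := by rw [he]; exact isStarProjection_starProjection
    exact ⟨hσ.1 (by rw [map_mul]; exact h.1), hσ.1 (by rw [map_star]; exact h.2)⟩
  refine ⟨1 - e, hproj.one_sub, ?_, fun h0 => ?_⟩
  · ext h
    refine htot _ fun s hs => ?_
    rw [adjoint_apply_of_mem_intertwiners hs, map_sub, map_one, he, sub_apply,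
      hsub _ ⟨s, hs, h, rfl⟩, one_apply_eq_self, sub_self]
  · have he1 : e = 1 := (sub_eq_zero.1 h0).symm
    rw [he1, map_one] at he
    rw [injective_iff_map_eq_zero]
    intro X hX
    refine hσ.1 ?_
    rw [map_zero]
    refine ContinuousLinearMap.eq_of_eq_on_of_eq_on_orthogonal (D := adjointRanges σ π) ?_
      fun k hk => ?_
    · rintro _ ⟨s, hs, h, rfl⟩
      rw [← adjoint_apply_of_mem_intertwiners hs, hX]
      simp
    · have := horth k hk
      rw [← he, one_apply_eq_self] at this
      rw [this, map_zero, map_zero]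

/-- If the intertwiners from a von Neumann algebra are total, the image of the representation
contains the unitaries of its double commutant. -/
theorem unitary_mem_range_of_intertwiners (hσ : IsVonNeumannRealization σ)
    (htot : ∀ h, (∀ s ∈ intertwiners σ π, s.adjoint h = 0) → h = 0) {U : H →L[ℂ] H}
    (hU : U ∈ unitary (H →L[ℂ] H)) (hcc : U ∈ centralizer (centralizer (range π))) :
    U ∈ range π := by
  -- The preimage of `U` is built on `L` by `s⋆ h ↦ s⋆ U h` and by zero on the orthogonal
  -- complement. It is well defined and norm preserving since `s t⋆` lies in the commutant of `π`
  -- and so commutes with `U`.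
  let e : (intertwiners σ π × H →₀ ℂ) →ₗ[ℂ] L :=
    Finsupp.linearCombination ℂ fun p => (p.1 : L →L[ℂ] H).adjoint p.2
  let f : (intertwiners σ π × H →₀ ℂ) →ₗ[ℂ] L :=
    Finsupp.linearCombination ℂ fun p => (p.1 : L →L[ℂ] H).adjoint (U p.2)
  have hinner : ∀ p q : intertwiners σ π × H,
      ⟪(p.1 : L →L[ℂ] H).adjoint (U p.2), (q.1 : L →L[ℂ] H).adjoint (U q.2)⟫_ℂ =
        ⟪(p.1 : L →L[ℂ] H).adjoint p.2, (q.1 : L →L[ℂ] H).adjoint q.2⟫_ℂ := by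
    intro p q
    have h1 : (p.1 : L →L[ℂ] H) ((q.1 : L →L[ℂ] H).adjoint (U q.2)) =
        U ((p.1 : L →L[ℂ] H) ((q.1 : L →L[ℂ] H).adjoint q.2)) :=
      congrArg (fun Z : H →L[ℂ] H => Z q.2) (hcc _ (comp_adjoint_mem_centralizer p.1.2 q.1.2))
    have h2 : ∀ h, star U (U h) = h := fun h =>
      congrArg (fun Z : H →L[ℂ] H => Z h) (Unitary.star_mul_self_of_mem hU)
    rw [ContinuousLinearMap.adjoint_inner_left, h1, ← ContinuousLinearMap.adjoint_inner_left,
      ← ContinuousLinearMap.star_eq_adjoint, h2, ContinuousLinearMap.adjoint_inner_left]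
  have hnorm : ∀ c, ‖f c‖ = ‖e c‖ := by
    intro c
    have : ⟪f c, f c⟫_ℂ = ⟪e c, e c⟫_ℂ := by
      simp only [e, f, Finsupp.linearCombination_apply, Finsupp.sum_inner, Finsupp.inner_sum,
        inner_smul_left, inner_smul_right, hinner]
    rw [inner_self_eq_norm_sq_to_K, inner_self_eq_norm_sq_to_K] at this
    have h2 : ‖f c‖ ^ 2 = ‖e c‖ ^ 2 := by exact_mod_cast this
    exact (pow_left_inj₀ (norm_nonneg _) (norm_nonneg _) two_ne_zero).1 h2
  obtain ⟨X, hX, hX0⟩ := exists_clm_of_norm_le f e 1 fun c => by rw [hnorm, one_mul]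
  have hXs : ∀ s ∈ intertwiners σ π, ∀ h, X (s.adjoint h) = s.adjoint (U h) := by
    intro s hs h
    have := hX (Finsupp.single (⟨s, hs⟩, h) 1)
    simpa [e, f] using this
  have hX0' : ∀ k, (∀ d ∈ adjointRanges σ π, ⟪d, k⟫_ℂ = 0) → X k = 0 := by
    intro k hk
    refine hX0 k fun c => ?_
    simp only [e, Finsupp.linearCombination_apply, Finsupp.sum_inner, inner_smul_left]
    refine Finset.sum_eq_zero fun p _ => ?_
    simp [hk _ ⟨p.1, p.1.2, p.2, rfl⟩]
  have hXcc : X ∈ centralizer (centralizer (range σ)) := by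
    intro T hT
    refine ContinuousLinearMap.eq_of_eq_on_of_eq_on_orthogonal (D := adjointRanges σ π) ?_
      fun k hk => ?_
    · rintro _ ⟨s, hs, h, rfl⟩
      have h1 : ∀ k, T (s.adjoint k) = (s ∘L star T).adjoint k := fun k => by
        rw [ContinuousLinearMap.adjoint_comp, ContinuousLinearMap.star_eq_adjoint,
          ContinuousLinearMap.adjoint_adjoint, ContinuousLinearMap.comp_apply]
      simp only [mul_apply_eq_comp]
      rw [hXs s hs, h1, h1, hXs _ (comp_mem_intertwiners hs (star_mem_centralizer_range σ hT))]
    · simp only [mul_apply_eq_comp]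
      rw [hX0' k hk, hX0' _ (inner_apply_eq_zero_of_orthogonal hT hk), map_zero]
  rw [hσ.2] at hXcc
  obtain ⟨x, hx⟩ := hXcc
  refine ⟨x, ?_⟩
  ext h
  refine sub_eq_zero.1 (htot _ fun s hs => ?_)
  rw [map_sub, adjoint_apply_of_mem_intertwiners hs, hx, hXs s hs, sub_self]

/-- The image of a von Neumann algebra under a representation with enough intertwiners equals its
double commutant. -/
theorem centralizer_centralizer_range_of_intertwiners (hσ : IsVonNeumannRealization σ)
    (htot : ∀ h, (∀ s ∈ intertwiners σ π, s.adjoint h = 0) → h = 0) :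
    centralizer (centralizer (range π)) = range π := by
  refine Subset.antisymm (fun Y hY => ?_) (subset_centralizer_centralizer)
  let B : StarSubalgebra ℂ (H →L[ℂ] H) := StarSubalgebra.centralizer ℂ (centralizer (range π))
  have hB : (B : Set (H →L[ℂ] H)) = centralizer (centralizer (range π)) := by
    rw [StarSubalgebra.coe_centralizer, union_eq_self_of_subset_right]
    intro T hT
    have := star_mem_centralizer_range π hT
    rwa [star_star] at this
  have : IsClosed (B : Set (H →L[ℂ] H)) := by
    rw [hB]
    exact isClosed_centralizer _
  -- The double commutant is a `C⋆`-algebra, hence spanned by its unitaries, which the preceding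
  -- theorem covers.
  have hspan := CStarAlgebra.span_unitary B
  have hYB : Y ∈ B := by rw [← SetLike.mem_coe, hB]; exact hY
  have key : ∀ Z : B, (Z : H →L[ℂ] H) ∈ LinearMap.range π.toAlgHom.toLinearMap := by
    intro Z
    have hZ : Z ∈ Submodule.span ℂ (unitary B : Set B) := by rw [hspan]; trivial
    induction hZ using Submodule.span_induction with
    | mem V hV =>
      refine unitary_mem_range_of_intertwiners hσ htot (U := V) ?_ ?_
      · exact ⟨congrArg Subtype.val hV.1, congrArg Subtype.val hV.2⟩
      · rw [← hB]; exact V.2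
    | zero => exact Submodule.zero_mem _
    | add a b _ _ ha hb => exact Submodule.add_mem _ ha hb
    | smul c a _ ha => exact Submodule.smul_mem _ c ha
  exact key ⟨Y, hYB⟩

/-- The diagonal action of a bounded operator on square-summable sequences. -/
noncomputable def amplification (T : L →L[ℂ] L) :
    lp (fun _ : ℕ => L) 2 →L[ℂ] lp (fun _ : ℕ => L) 2 :=
  haveI : IsBoundedSMul (L →L[ℂ] L) L := IsBoundedSMul.of_norm_smul_le fun T v => T.le_opNorm v
  LinearMap.mkContinuous
    { toFun := fun k => T • k
      map_add' := smul_add T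
      map_smul' := fun c k => smul_comm T c k } ‖T‖ fun k => norm_smul_le T k

theorem amplification_apply (T : L →L[ℂ] L) (k : lp (fun _ : ℕ => L) 2) (n : ℕ) :
    amplification T k n = T (k n) := rfl

theorem amplification_mul_apply (S T : L →L[ℂ] L) (k : lp (fun _ : ℕ => L) 2) :
    amplification (S * T) k = amplification S (amplification T k) := rfl

theorem inner_amplification_left (X : M) (a b : lp (fun _ : ℕ => L) 2) :
    ⟪amplification (σ X) a, b⟫_ℂ = ⟪a, amplification (σ (star X)) b⟫_ℂ := by
  rw [lp.inner_eq_tsum, lp.inner_eq_tsum]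
  exact tsum_congr fun n => apply_inner_left σ X _ _

/-- A cyclic vector of a representation whose vector state is normal is the image of a
square-summable sequence under a bounded intertwiner. -/
theorem exists_intertwiner_amplification {x y : ℕ → L}
    (hx : Summable fun n => ‖x n‖ ^ 2) (hy : Summable fun n => ‖y n‖ ^ 2) {Ω : H}
    (hω : ∀ X : M, HasSum (fun n => ⟪x n, σ X (y n)⟫_ℂ) ⟪Ω, π X Ω⟫_ℂ) :
    ∃ S : lp (fun _ : ℕ => L) 2 →L[ℂ] H,
      (∀ X k, S (amplification (σ X) k) = π X (S k)) ∧ ∃ ξ, S ξ = Ω := by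
  have hmem : ∀ {x : ℕ → L}, (Summable fun n => ‖x n‖ ^ 2) → Memℓp x 2 := fun hx =>
    memℓp_gen (by simpa using hx)
  let x' : lp (fun _ : ℕ => L) 2 := ⟨x, hmem hx⟩
  let y' : lp (fun _ : ℕ => L) 2 := ⟨y, hmem hy⟩
  have hω' : ∀ X, ⟪Ω, π X Ω⟫_ℂ = ⟪x', amplification (σ X) y'⟫_ℂ := fun X =>
    (hω X).unique (lp.hasSum_inner x' (amplification (σ X) y'))
  -- The vector `x' + y'` is used because `‖π X Ω‖² = ⟪X x', X y'⟫` is at most a quarter of `‖X (x'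
  -- + y')‖²`; thus `X (x' + y') ↦ π X Ω` extends to a bounded map.
  let e : M →ₗ[ℂ] lp (fun _ : ℕ => L) 2 :=
    { toFun := fun X => amplification (σ X) (x' + y')
      map_add' := fun X Y => by
        ext n
        rw [lp.coeFn_add, Pi.add_apply, amplification_apply, amplification_apply,
          amplification_apply, map_add, add_apply]
      map_smul' := fun c X => by
        ext n
        rw [lp.coeFn_smul, Pi.smul_apply, amplification_apply, amplification_apply, map_smul,
          smul_apply, RingHom.id_apply] }
  have he : ∀ X Y, amplification (σ X) (e Y) = e (X * Y) := fun X Y => by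
    change _ = amplification (σ (X * Y)) (x' + y')
    rw [map_mul, amplification_mul_apply]
    rfl
  let f : M →ₗ[ℂ] H :=
    { toFun := fun X => π X Ω
      map_add' := fun X Y => by rw [map_add, add_apply]
      map_smul' := fun c X => by rw [map_smul, smul_apply, RingHom.id_apply] }
  have hnorm : ∀ X, ‖f X‖ ≤ 1 * ‖e X‖ := by
    intro X
    have h1 : ⟪f X, f X⟫_ℂ = ⟪amplification (σ X) x', amplification (σ X) y'⟫_ℂ := by
      change ⟪π X Ω, π X Ω⟫_ℂ = _
      rw [apply_inner_left, ← mul_apply_eq_comp, ← map_mul, hω', map_mul, amplification_mul_apply,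
        inner_amplification_left]
    have h2 : ‖f X‖ ^ 2 = RCLike.re ⟪amplification (σ X) x', amplification (σ X) y'⟫_ℂ := by
      rw [← h1, inner_self_eq_norm_sq]
    have h3 : e X = amplification (σ X) x' + amplification (σ X) y' :=
      (amplification (σ X)).map_add x' y'
    have h4 := four_mul_re_inner_le (amplification (σ X) x') (amplification (σ X) y')
    rw [one_mul]
    refine le_of_sq_le_sq ?_ (norm_nonneg _)
    rw [← h3, ← h2] at h4
    linarith [sq_nonneg ‖f X‖]
  obtain ⟨S, hS, hS0⟩ := exists_clm_of_norm_le f e 1 hnorm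
  refine ⟨S, fun X k => ?_, e 1, ?_⟩
  · have : S ∘L amplification (σ X) = π X ∘L S := by
      refine ContinuousLinearMap.eq_of_eq_on_of_eq_on_orthogonal (D := range e) ?_ fun k hk => ?_
      · rintro _ ⟨Y, rfl⟩
        rw [ContinuousLinearMap.comp_apply, ContinuousLinearMap.comp_apply, he, hS, hS]
        change π (X * Y) Ω = π X (π Y Ω)
        rw [map_mul, mul_apply_eq_comp]
      · rw [ContinuousLinearMap.comp_apply, ContinuousLinearMap.comp_apply,
          hS0 k fun Y => hk _ ⟨Y, rfl⟩, map_zero]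
        refine hS0 _ fun Y => ?_
        rw [← star_star X, ← inner_amplification_left, he]
        exact hk _ ⟨_, rfl⟩
    exact congrArg (fun Z : lp (fun _ : ℕ => L) 2 →L[ℂ] H => Z k) this
  · rw [hS]
    change π 1 Ω = Ω
    rw [map_one, one_apply_eq_self]

/-- The cyclic representation of a normal state has enough intertwiners. -/
theorem eq_zero_of_adjoint_intertwiners_eq_zero {x y : ℕ → L}
    (hx : Summable fun n => ‖x n‖ ^ 2) (hy : Summable fun n => ‖y n‖ ^ 2) {Ω : H}
    (hω : ∀ X : M, HasSum (fun n => ⟪x n, σ X (y n)⟫_ℂ) ⟪Ω, π X Ω⟫_ℂ)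
    (hcyc : Dense (range fun X => π X Ω)) (h : H)
    (hh : ∀ s ∈ intertwiners σ π, s.adjoint h = 0) : h = 0 := by
  obtain ⟨S, hS, ξ, rfl⟩ := exists_intertwiner_amplification hx hy hω
  -- The components of `S` are intertwiners from `L` itself. If all their adjoints kill `h`, then
  -- `h` is orthogonal to the range of `S`, which contains the cyclic subspace.
  have hcomp : ∀ n, S ∘L lp.singleContinuousLinearMap ℂ (fun _ : ℕ => L) 2 n ∈
      intertwiners σ π := by
    intro n X v
    rw [ContinuousLinearMap.comp_apply, ContinuousLinearMap.comp_apply, ← hS]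
    congr 1
    ext i
    rw [amplification_apply]
    simp only [lp.singleContinuousLinearMap_apply, lp.coeFn_single]
    by_cases hi : i = n
    · subst hi; simp
    · simp [Pi.single_eq_of_ne hi]
  have hSh : S.adjoint h = 0 := by
    ext n
    have h1 := hh _ (hcomp n)
    refine ext_inner_left ℂ fun v => ?_
    have h2 : ⟪v, (S ∘L lp.singleContinuousLinearMap ℂ (fun _ : ℕ => L) 2 n).adjoint h⟫_ℂ = 0 := by
      rw [h1, inner_zero_right]
    rw [ContinuousLinearMap.adjoint_inner_right, ContinuousLinearMap.comp_apply,
      ← ContinuousLinearMap.adjoint_inner_right, lp.singleContinuousLinearMap_apply,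
      lp.inner_single_left] at h2
    rw [h2]
    simp
  have h0 : (fun k => ⟪k, h⟫_ℂ) = fun _ => 0 := by
    refine Continuous.ext_on hcyc (by fun_prop) (by fun_prop) ?_
    rintro _ ⟨X, rfl⟩
    change ⟪π X (S ξ), h⟫_ℂ = 0
    rw [← hS, ← ContinuousLinearMap.adjoint_inner_right, hSh, inner_zero_right]
  exact inner_self_eq_zero.1 (congrFun h0 h)

end Intertwiners

/-! ### The vacuum representation of a local net -/

namespace LocalNet

variable {A : Type*} [CStarAlgebra A] {𝔄 : LocalNet A}
  {H : Type*} [NormedAddCommGroup H] [InnerProductSpace ℂ H] [CompleteSpace H]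

theorem alg_le_complAlg {O O₁ : Set M4} (h₁ : O₁ ∈ 𝔄.regions) (h : CausallySeparated O₁ O) :
    𝔄.alg O₁ ≤ 𝔄.complAlg O := by
  intro X hX
  refine StarSubalgebra.le_topologicalClosure _ (StarAlgebra.subset_adjoin ℂ _ ?_)
  exact mem_iUnion₂.2 ⟨O₁, ⟨h₁, h⟩, hX⟩

theorem complAlg_anti {O Q : Set M4} (h : O ⊆ Q) : 𝔄.complAlg Q ≤ 𝔄.complAlg O :=
  StarSubalgebra.topologicalClosure_mono (StarAlgebra.adjoin_mono (biUnion_subset_biUnion_left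
    fun _ hO => ⟨hO.1, fun _ hx y hy => hO.2 hx y (h hy)⟩))

theorem star_mem_dual {π : A →⋆ₐ[ℂ] (H →L[ℂ] H)} {O : Set M4} {Y : H →L[ℂ] H}
    (hY : Y ∈ 𝔄.dual π O) : star Y ∈ 𝔄.dual π O := by
  rintro _ ⟨B, hB, rfl⟩
  have h := congrArg star (hY _ ⟨star B, star_mem hB, rfl⟩)
  rw [map_star, star_mul, star_mul, star_star] at h
  exact h.symm

theorem commute_of_mem_complAlg {O : Set M4} (hO : O ∈ 𝔄.regions) {X B : A} (hX : X ∈ 𝔄.alg O)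
    (hB : B ∈ 𝔄.complAlg O) : X * B = B * X := by
  have hle : 𝔄.complAlg O ≤ StarSubalgebra.centralizer ℂ (𝔄.alg O : Set A) := by
    refine StarSubalgebra.topologicalClosure_minimal (StarAlgebra.adjoin_le ?_) ?_
    · refine iUnion₂_subset fun O₁ hO₁ Y hY => ?_
      rw [SetLike.mem_coe, StarSubalgebra.mem_centralizer_iff]
      intro Z hZ
      exact ⟨(𝔄.locality O₁ hO₁.1 O hO hO₁.2 Y hY Z hZ).symm,
        (𝔄.locality O₁ hO₁.1 O hO hO₁.2 Y hY _ (star_mem hZ)).symm⟩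
    · rw [StarSubalgebra.coe_centralizer]
      exact isClosed_centralizer _
  exact ((StarSubalgebra.mem_centralizer_iff ℂ).1 (hle hB) X hX).1

theorem range_comp_subtype (π : A →⋆ₐ[ℂ] (H →L[ℂ] H)) (S : StarSubalgebra ℂ A) :
    range (π.comp S.subtype) = π '' (S : Set A) := by
  ext Y
  simp

theorem neg_tip_mem_forwardCone {r : ℝ} (hr : 0 < r) :
    r • timeVec - -(r • timeVec) ∈ forwardCone := by
  have h := smul_mem_forwardCone hr timeVec_mem_forwardCone
  rw [sub_neg_eq_add]
  exact add_mem_forwardCone h (forwardCone_subset_closedForwardCone h)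

theorem doubleCone_neg_mem_regions {r : ℝ} (hr : 0 < r) :
    doubleCone (-(r • timeVec)) (r • timeVec) ∈ 𝔄.regions :=
  𝔄.doubleCone_mem _ (isDoubleCone_doubleCone (neg_tip_mem_forwardCone hr))

/-- The local algebras of the double cones that contain a given bounded set are jointly dense. -/
theorem induction_on_doubleCones {p : A → Prop} (hp : IsClosed {X | p X}) {O : Set M4}
    (hO : Bornology.IsBounded O)
    (h : ∀ r : ℝ, 0 < r → O ⊆ doubleCone (-(r • timeVec)) (r • timeVec) →
      ∀ X ∈ 𝔄.alg (doubleCone (-(r • timeVec)) (r • timeVec)), p X) (X : A) : p X := by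
  refine hp.closure_subset_iff.2 ?_ (𝔄.dense X)
  refine iUnion₂_subset fun Q hQ Y hY => ?_
  obtain ⟨r₀, hr₀⟩ := exists_subset_doubleCone (hO.union (𝔄.bounded_of_mem Q hQ))
  have hr : (0 : ℝ) < max r₀ 1 := lt_max_of_lt_right one_pos
  have hsub := hr₀ _ (le_max_left r₀ 1)
  exact h _ hr (subset_union_left.trans hsub) Y
    (𝔄.isotony Q hQ _ (doubleCone_neg_mem_regions hr) (subset_union_right.trans hsub) hY)

end LocalNet

/-! ### Von Neumann property and faithfulness of the vacuum representation -/

namespace LocalNet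

variable {A : Type u} [CStarAlgebra A] {𝔄 : LocalNet A}
  {H : Type v} [NormedAddCommGroup H] [InnerProductSpace ℂ H] [CompleteSpace H]
  {ω : A →ₗ[ℂ] ℂ} {π : A →⋆ₐ[ℂ] (H →L[ℂ] H)} {Ω : H}

/-- In the vacuum representation the local algebras are realised with total intertwiners. -/
theorem IsVacuum.exists_realization (hvac : 𝔄.IsVacuum ω π Ω) {O : Set M4}
    (hO : O ∈ 𝔄.regions) :
    ∃ (L : Type u) (_ : NormedAddCommGroup L) (_ : InnerProductSpace ℂ L) (_ : CompleteSpace L)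
      (σ : 𝔄.alg O →⋆ₐ[ℂ] (L →L[ℂ] L)), IsVonNeumannRealization σ ∧
      ∀ h, (∀ s ∈ intertwiners σ (π.comp (𝔄.alg O).subtype), s.adjoint h = 0) → h = 0 := by
  obtain ⟨L, i₁, i₂, i₃, σ, hσ, x, y, hx, hy, hsum⟩ := hvac.locallyNormal O hO
  refine ⟨L, i₁, i₂, i₃, σ, hσ, fun h hh => ?_⟩
  refine eq_zero_of_adjoint_intertwiners_eq_zero (Ω := Ω) hx hy (fun X => ?_) ?_ h hh
  · have := hsum X
    rwa [show (ω ∘ₗ (𝔄.alg O).subtype.toAlgHom.toLinearMap) X = _ from hvac.gns X] at this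
  · have := hvac.cyclic O hO
    rw [image_eq_range] at this
    exact this

theorem IsVacuum.centralizer_centralizer_image (hvac : 𝔄.IsVacuum ω π Ω) {O : Set M4}
    (hO : O ∈ 𝔄.regions) :
    centralizer (centralizer (π '' (𝔄.alg O : Set A))) = π '' (𝔄.alg O : Set A) := by
  obtain ⟨L, i₁, i₂, i₃, σ, hσ, htot⟩ := hvac.exists_realization hO
  rw [← range_comp_subtype]
  exact centralizer_centralizer_range_of_intertwiners hσ htot

theorem IsVacuum.ne_zero (hvac : 𝔄.IsVacuum ω π Ω) : Ω ≠ 0 := by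
  rintro rfl
  have := hvac.gns 1
  rw [hvac.isState.2, inner_zero_left] at this
  exact one_ne_zero this

/-- Failure of injectivity would give a nonzero projection `e` with `π e = 0`. Property B makes `e`
equivalent to `1` in a larger cone, so that `π 1 = 0`, which contradicts `Ω ≠ 0`. -/
theorem IsVacuum.injective_on_doubleCone (hvac : 𝔄.IsVacuum ω π Ω) (hB : 𝔄.PropertyB)
    {p q : M4} (hpq : q - p ∈ forwardCone) :
    Function.Injective (π.comp (𝔄.alg (doubleCone p q)).subtype) := by
  have hD := 𝔄.doubleCone_mem _ (isDoubleCone_doubleCone hpq)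
  obtain ⟨L, i₁, i₂, i₃, σ, hσ, htot⟩ := hvac.exists_realization hD
  obtain ⟨e, he, he0, hinj⟩ := exists_isStarProjection_map_eq_zero hσ htot
  refine hinj ?_
  by_contra hne
  have hss := closure_doubleCone_ssubset hpq
  have hD' : doubleCone (p - timeVec) (q + timeVec) ∈ 𝔄.regions := by
    refine 𝔄.doubleCone_mem _ (isDoubleCone_doubleCone ?_)
    have ht := forwardCone_subset_closedForwardCone timeVec_mem_forwardCone
    convert add_mem_forwardCone (add_mem_forwardCone hpq ht) ht using 1
    abel
  obtain ⟨W, -, hW1, hW2⟩ := hB (doubleCone p q, doubleCone (p - timeVec) (q + timeVec))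
    ⟨hD, hD', hss⟩ e e.2 ⟨congrArg Subtype.val he.1, congrArg Subtype.val he.2⟩
    (fun h => hne (Subtype.ext h))
  have he0' : π (e : A) = 0 := he0
  have h1 : π (1 : A) = 0 := by
    have : (1 : A) = star W * (W * star W) * W := by
      rw [← mul_assoc, hW1, one_mul, hW1]
    rw [this, map_mul, map_mul, hW2, he0', mul_zero, zero_mul]
  rw [map_one] at h1
  exact hvac.ne_zero (by simpa using congrArg (fun Z : H →L[ℂ] H => Z Ω) h1)

theorem IsVacuum.isometry (hvac : 𝔄.IsVacuum ω π Ω) (hB : 𝔄.PropertyB) : Isometry π := by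
  have hc : Continuous π := map_continuous π
  refine AddMonoidHomClass.isometry_of_norm π fun X => ?_
  refine induction_on_doubleCones (𝔄 := 𝔄) (p := fun X => ‖π X‖ = ‖X‖)
    (isClosed_eq hc.norm continuous_norm) Bornology.isBounded_empty (fun r hr _ Y hY => ?_) X
  have : IsClosed (𝔄.alg (doubleCone (-(r • timeVec)) (r • timeVec)) : Set A) :=
    𝔄.isClosed_alg _ (doubleCone_neg_mem_regions hr)
  exact NonUnitalStarAlgHom.norm_map (π.comp (𝔄.alg _).subtype)
    (hvac.injective_on_doubleCone hB (neg_tip_mem_forwardCone hr)) ⟨Y, hY⟩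

end LocalNet

/-! ### Isometries and Stinespring representations -/

section Isometry

variable {M : Type*} [Ring M] [StarRing M] [Algebra ℂ M]
  {H : Type*} [NormedAddCommGroup H] [InnerProductSpace ℂ H] [CompleteSpace H]
  {K : Type*} [NormedAddCommGroup K] [InnerProductSpace ℂ K] [CompleteSpace K]

/-- An isometry that compresses `π₁` to `π` on `B` and `B⋆ B` intertwines them on `B`. -/
theorem intertwines_of_compression {π : M →⋆ₐ[ℂ] (H →L[ℂ] H)} {π₁ : M →⋆ₐ[ℂ] (K →L[ℂ] K)}
    {V : H →L[ℂ] K} (hV : ∀ h, V.adjoint (V h) = h) {B : M}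
    (h1 : ∀ h, V.adjoint (π₁ B (V h)) = π B h)
    (h2 : ∀ h, V.adjoint (π₁ (star B * B) (V h)) = π (star B * B) h) (h : H) :
    V (π B h) = π₁ B (V h) := by
  -- Multiplicative domain argument: all four terms of `‖V π(B) h - π₁(B) V h‖²` have the same
  -- modulus and cancel.
  have e1 : ⟪π₁ B (V h), π₁ B (V h)⟫_ℂ = ⟪π B h, π B h⟫_ℂ := by
    rw [apply_inner_left, apply_inner_left, ← mul_apply_eq_comp, ← mul_apply_eq_comp, ← map_mul,
      ← map_mul, ← h2, ContinuousLinearMap.adjoint_inner_right]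
  have e2 : ⟪π₁ B (V h), V (π B h)⟫_ℂ = ⟪π B h, π B h⟫_ℂ := by
    rw [← ContinuousLinearMap.adjoint_inner_left, h1]
  have e3 : ⟪V (π B h), π₁ B (V h)⟫_ℂ = ⟪π B h, π B h⟫_ℂ := by
    rw [← ContinuousLinearMap.adjoint_inner_right, h1]
  have e4 : ⟪V (π B h), V (π B h)⟫_ℂ = ⟪π B h, π B h⟫_ℂ := by
    rw [← ContinuousLinearMap.adjoint_inner_right, hV]
  rw [← sub_eq_zero, ← inner_self_eq_zero (𝕜 := ℂ), inner_sub_left, inner_sub_right,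
    inner_sub_right, e1, e2, e3, e4]
  ring

/-- The representation unitarily equivalent to `π₁` through `U`. -/
noncomputable def conjRep (π₁ : M →⋆ₐ[ℂ] (K →L[ℂ] K)) (U : H →L[ℂ] K)
    (h₁ : U.adjoint ∘L U = 1) (h₂ : U ∘L U.adjoint = 1) : M →⋆ₐ[ℂ] (H →L[ℂ] H) where
  toFun X := U.adjoint ∘L π₁ X ∘L U
  map_one' := by
    rw [map_one, ← h₁]
    rfl
  map_mul' X Y := by
    ext h
    have h3 : ∀ k, U (U.adjoint k) = k := fun k => congrArg (fun Z : K →L[ℂ] K => Z k) h₂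
    simp [h3]
  map_zero' := by simp
  map_add' X Y := by ext h; simp
  commutes' c := by
    ext h
    have h3 : ∀ k, U.adjoint (U k) = k := fun k => congrArg (fun Z : H →L[ℂ] H => Z k) h₁
    simp [Algebra.algebraMap_eq_smul_one, h3]
  map_star' X := by
    rw [map_star, ContinuousLinearMap.star_eq_adjoint, ContinuousLinearMap.star_eq_adjoint,
      ContinuousLinearMap.adjoint_comp, ContinuousLinearMap.adjoint_comp,
      ContinuousLinearMap.adjoint_adjoint]
    rfl

theorem conjRep_apply (π₁ : M →⋆ₐ[ℂ] (K →L[ℂ] K)) (U : H →L[ℂ] K)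
    (h₁ : U.adjoint ∘L U = 1) (h₂ : U ∘L U.adjoint = 1) (X : M) (h : H) :
    conjRep π₁ U h₁ h₂ X h = U.adjoint (π₁ X (U h)) := rfl

end Isometry

/-! ### Local states, corresponding endomorphisms and implementing isometries -/

namespace LocalNet

variable {A : Type u} [CStarAlgebra A] {𝔄 : LocalNet A}
  {H : Type v} [NormedAddCommGroup H] [InnerProductSpace ℂ H] [CompleteSpace H]
  {ω : A →ₗ[ℂ] ℂ} {π : A →⋆ₐ[ℂ] (H →L[ℂ] H)} {Ω : H}

/-- A representation on the vacuum space which coincides with the vacuum representation on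
`A(O')` has the same range, by Haag duality. -/
theorem IsVacuum.mem_range_of_eq_on_complAlg (hvac : 𝔄.IsVacuum ω π Ω) (hB : 𝔄.PropertyB)
    (hHaag : 𝔄.HaagDuality π) {O : Set M4} (hO : Bornology.IsBounded O)
    (τ : A →⋆ₐ[ℂ] (H →L[ℂ] H)) (hτ : ∀ B ∈ 𝔄.complAlg O, τ B = π B) (X : A) :
    τ X ∈ range π := by
  have hcl : IsClosed (range π) := (hvac.isometry hB).isClosedEmbedding.isClosed_range
  refine induction_on_doubleCones (𝔄 := 𝔄) (p := fun X => τ X ∈ range π)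
    (hcl.preimage (map_continuous τ)) hO (fun r hr hsub Y hY => ?_) X
  set R := doubleCone (-(r • timeVec)) (r • timeVec) with hR
  have hRm : R ∈ 𝔄.regions := doubleCone_neg_mem_regions hr
  -- On `A(R')` the representations `τ` and `π` agree, so locality in `τ` places `τ Y` in the
  -- commutant of `π(A(R'))`.
  have hmem : τ Y ∈ 𝔄.dual π R := by
    rintro _ ⟨B, hBR, rfl⟩
    rw [← hτ B (complAlg_anti hsub hBR), ← map_mul, ← map_mul, commute_of_mem_complAlg hRm hY hBR]
  rw [hHaag R (isDoubleCone_doubleCone (neg_tip_mem_forwardCone hr)),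
    hvac.centralizer_centralizer_image hRm] at hmem
  exact image_subset_range _ _ hmem

variable [PartialOrder A] [StarOrderedRing A] {Λ : Set M4 × Set M4} {T : A →CP A}

theorem IsLocalState.apply_of_mem (hT : 𝔄.IsLocalState Λ T) {B : A}
    (hB : B ∈ 𝔄.complAlg Λ.2) : T B = B := by
  have := hT.2.1 1 B hB
  rwa [one_mul, hT.1, one_mul] at this

theorem IsLocalState.apply_mul_left (hT : 𝔄.IsLocalState Λ T) {B : A}
    (hB : B ∈ 𝔄.complAlg Λ.2) (X : A) : T (B * X) = B * T X := by
  have h := hT.2.1 (star X) (star B) (star_mem hB)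
  have h2 := congrArg star h
  rwa [star_mul, ← map_star, ← map_star, star_mul, star_star, star_star] at h2

/-- Local states leave the local algebras of the larger double cones invariant. -/
theorem IsLocalState.map_mem_alg (hT : 𝔄.IsLocalState Λ T) (hvac : 𝔄.IsVacuum ω π Ω)
    (hB : 𝔄.PropertyB) (hHaag : 𝔄.HaagDuality π) {R : Set M4} (hR : IsDoubleCone R)
    (hsub : Λ.2 ⊆ R) {X : A} (hX : X ∈ 𝔄.alg R) : T X ∈ 𝔄.alg R := by
  have hRm := 𝔄.doubleCone_mem R hR
  have hmem : π (T X) ∈ 𝔄.dual π R := by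
    rintro _ ⟨B, hBR, rfl⟩
    have hB' := complAlg_anti hsub hBR
    rw [← map_mul, ← map_mul, ← hT.2.1 X B hB', ← hT.apply_mul_left hB' X,
      commute_of_mem_complAlg hRm hX hBR]
  rw [hHaag R hR, hvac.centralizer_centralizer_image hRm] at hmem
  obtain ⟨Y, hY, hYX⟩ := hmem
  rwa [← (hvac.isometry hB).injective hYX]

/-- A local state with property DHR has a corresponding localized endomorphism. -/
theorem IsLocalState.exists_corresponds (hT : 𝔄.IsLocalState Λ T) (hΛ : Λ ∈ 𝔄.doubleConePairs)
    (hvac : 𝔄.IsVacuum ω π Ω) (hB : 𝔄.PropertyB) (hHaag : 𝔄.HaagDuality π)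
    {K : Type w} [NormedAddCommGroup K] [InnerProductSpace ℂ K] [CompleteSpace K]
    {π₁ : A →⋆ₐ[ℂ] (K →L[ℂ] K)} {V : H →L[ℂ] K}
    (hS : IsMinimalStinespring (fun X => π (T X)) π₁ V) (hDHR : 𝔄.PropertyDHR π₁)
    {O : Set M4} (hO : IsDoubleCone O) (hcl : closure Λ.2 ⊂ O) :
    ∃ ρ : π.range →⋆ₐ[ℂ] π.range, 𝔄.Corresponds π O T ρ := by
  have hOm := 𝔄.doubleCone_mem O hO
  have hsub : Λ.2 ⊆ O := subset_closure.trans hcl.subset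
  have hST : ∀ X h, V.adjoint (π₁ X (V h)) = π (T X) h := fun X h =>
    (congrArg (fun Z : H →L[ℂ] H => Z h) (hS.1 X)).symm
  have hV : ∀ h, V.adjoint (V h) = h := fun h => by
    have := hST 1 h
    rwa [map_one, hT.1, map_one] at this
  have hVB : ∀ B ∈ 𝔄.complAlg Λ.2, ∀ h, V (π B h) = π₁ B (V h) := fun B hBm =>
    intertwines_of_compression hV (fun h => by rw [hST, hT.apply_of_mem hBm])
      fun h => by rw [hST, hT.apply_of_mem (mul_mem (star_mem hBm) hBm)]
  have hVB' : ∀ B ∈ 𝔄.complAlg Λ.2, ∀ k, V.adjoint (π₁ B k) = π B (V.adjoint k) := by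
    intro B hBm k
    refine ext_inner_left ℂ fun h => ?_
    rw [ContinuousLinearMap.adjoint_inner_right, ← star_star B, ← apply_inner_left,
      ← hVB _ (star_mem hBm), ← apply_inner_left, ContinuousLinearMap.adjoint_inner_right]
  have hE : V ∘L V.adjoint ∈ 𝔄.dual π₁ Λ.2 := by
    rintro _ ⟨B, hBm, rfl⟩
    ext k
    simp only [mul_apply_eq_comp, ContinuousLinearMap.comp_apply]
    rw [hVB' B hBm, hVB B hBm]
  have hEp : IsStarProjection (V ∘L V.adjoint) := by
    refine ⟨?_, ?_⟩
    · ext k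
      simp only [mul_apply_eq_comp, ContinuousLinearMap.comp_apply, hV]
    · change star (V ∘L V.adjoint) = _
      rw [ContinuousLinearMap.star_eq_adjoint, ContinuousLinearMap.adjoint_comp,
        ContinuousLinearMap.adjoint_adjoint]
  have hE0 : V ∘L V.adjoint ≠ 0 := by
    intro h0
    have h1 : V (V.adjoint (V Ω)) = 0 := congrArg (fun Z : K →L[ℂ] K => Z (V Ω)) h0
    rw [hV] at h1
    refine hvac.ne_zero ?_
    rw [← hV Ω, h1, map_zero]
  -- Property DHR is applied one step outside the inclusion pair, since `V V⋆` is only known to lie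
  -- in the dual of the outer region. This is why `O` must contain the closure of `Λ.2`.
  obtain ⟨W, hW, hW1, hW2⟩ := hDHR (Λ.2, O) ⟨⟨hΛ.1.2.1, hOm, hcl⟩, hΛ.2.2, hO⟩ _ hE hEp hE0
  have hW1' : ∀ k, star W (W k) = k := fun k => congrArg (fun Z : K →L[ℂ] K => Z k) hW1
  have hW2' : ∀ k, W (star W k) = V (V.adjoint k) := fun k =>
    congrArg (fun Z : K →L[ℂ] K => Z k) hW2
  have hWB' : ∀ B ∈ 𝔄.complAlg O, ∀ k, star W (π₁ B k) = π₁ B (star W k) := fun B hBm k =>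
    (congrArg (fun Z : K →L[ℂ] K => Z k) (star_mem_dual hW _ ⟨B, hBm, rfl⟩)).symm
  -- Both `V` and `W` are isometries with range projection `V V⋆`, so `U` is unitary; it intertwines
  -- `π` and `π₁` on `A(O')`.
  set U : H →L[ℂ] K := star W ∘L V with hU
  have hUad : U.adjoint = V.adjoint ∘L W := by
    rw [hU, ContinuousLinearMap.adjoint_comp, ContinuousLinearMap.star_eq_adjoint,
      ContinuousLinearMap.adjoint_adjoint]
  have hU1 : U.adjoint ∘L U = 1 := by
    rw [hUad]
    ext h
    simp only [hU, ContinuousLinearMap.comp_apply, hW2', hV, one_apply_eq_self]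
  have hU2 : U ∘L U.adjoint = 1 := by
    rw [hUad]
    ext k
    simp only [hU, ContinuousLinearMap.comp_apply, ← hW2', hW1', one_apply_eq_self]
  have hU1' : ∀ h, U.adjoint (U h) = h := fun h => congrArg (fun Z : H →L[ℂ] H => Z h) hU1
  have hU2' : ∀ k, U (U.adjoint k) = k := fun k => congrArg (fun Z : K →L[ℂ] K => Z k) hU2
  have hUB : ∀ B ∈ 𝔄.complAlg O, ∀ h, U (π B h) = π₁ B (U h) := fun B hBm h => by
    simp only [hU, ContinuousLinearMap.comp_apply]
    rw [hVB B (complAlg_anti hsub hBm), hWB' B hBm]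
  set τ := conjRep π₁ U hU1 hU2 with hτ
  have hτB : ∀ B ∈ 𝔄.complAlg O, τ B = π B := fun B hBm => by
    ext h
    rw [hτ, conjRep_apply, ← hUB B hBm, hU1']
  have hmem := hvac.mem_range_of_eq_on_complAlg hB hHaag (𝔄.bounded_of_mem O hOm) τ hτB
  -- Faithfulness of `π` lets `τ` descend to an endomorphism of `π(A)`.
  let ε := StarAlgEquiv.ofInjective π (hvac.isometry hB).injective
  let ρ : π.range →⋆ₐ[ℂ] π.range :=
    (τ.codRestrict π.range fun X => hmem X).comp (ε.symm : π.range →⋆ₐ[ℂ] A)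
  have hρ : ∀ X, (ρ (π.rangeRestrict X) : H →L[ℂ] H) = τ X := fun X => by
    have : ε.symm (π.rangeRestrict X) = X := ε.symm_apply_apply X
    change τ (ε.symm (π.rangeRestrict X)) = τ X
    rw [this]
  refine ⟨ρ, fun B hBm => Subtype.ext ?_, U.adjoint ∘L V, ?_, fun X => ?_, ?_⟩
  · rw [hρ, hτB B hBm]
    rfl
  · rintro _ ⟨B, hBm, rfl⟩
    ext h
    simp only [mul_apply_eq_comp, ContinuousLinearMap.comp_apply]
    rw [hVB B (complAlg_anti hsub hBm), ← hU2' (V h), ← hUB B hBm, hU1', hU1']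
  · ext h
    change π (T X) h = (U.adjoint ∘L V).adjoint ((ρ (π.rangeRestrict X) : H →L[ℂ] H)
      ((U.adjoint ∘L V) h))
    rw [hρ, hτ, conjRep_apply, ContinuousLinearMap.adjoint_comp,
      ContinuousLinearMap.adjoint_adjoint]
    simp only [ContinuousLinearMap.comp_apply, hU2', hST]
  · have hset : {k : H | ∃ X h, k = endoRep π ρ X ((U.adjoint ∘L V) h)} =
        U.adjoint '' {k : K | ∃ X h, k = π₁ X (V h)} := by
      have hk : ∀ X h, endoRep π ρ X ((U.adjoint ∘L V) h) = U.adjoint (π₁ X (V h)) := by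
        intro X h
        change (ρ (π.rangeRestrict X) : H →L[ℂ] H) ((U.adjoint ∘L V) h) = _
        rw [hρ, hτ, conjRep_apply, show (U.adjoint ∘L V) h = U.adjoint (V h) from rfl, hU2']
      ext k
      constructor
      · rintro ⟨X, h, rfl⟩
        exact ⟨_, ⟨X, h, rfl⟩, (hk X h).symm⟩
      · rintro ⟨_, ⟨X, h, rfl⟩, rfl⟩
        exact ⟨X, h, (hk X h).symm⟩
    have hdense := hS.2
    rw [← Submodule.dense_iff_topologicalClosure_eq_top] at hdense ⊢
    rw [hset]
    have hmap : (Submodule.span ℂ (U.adjoint '' {k : K | ∃ X h, k = π₁ X (V h)}) : Set H) =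
        U.adjoint '' (Submodule.span ℂ {k : K | ∃ X h, k = π₁ X (V h)}) :=
      congrArg SetLike.coe (Submodule.span_image (U.adjoint : K →ₗ[ℂ] H))
    rw [hmap]
    exact DenseRange.dense_image (Function.Surjective.denseRange fun h => ⟨U h, hU1' h⟩)
      U.adjoint.continuous hdense

/-- Far away from the localization region a local state with transportable corresponding
endomorphisms is implemented by an isometry. -/
theorem Corresponds.exists_isometry {O : Set M4}
    {ρ : π.range →⋆ₐ[ℂ] π.range} (hρ : 𝔄.Corresponds π O T ρ) (htr : 𝔄.IsTransportable π O ρ)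
    (a : M4) :
    ∃ W : H →L[ℂ] H, ∀ X ∈ 𝔄.complAlg (translateRegion a O), π (T X) = star W * π X * W := by
  obtain ⟨-, V, -, hV, -⟩ := hρ
  obtain ⟨ρ', hρ', U, -, -, hU⟩ := htr a
  refine ⟨star U * V, fun X hX => ?_⟩
  have h1 : endoRep π ρ X = U * π X * star U := by
    change (ρ (π.rangeRestrict X) : H →L[ℂ] H) = _
    rw [hU, hρ' X hX]
    rfl
  have h2 : π (T X) = star V * endoRep π ρ X * V := hV X
  rw [h2, h1, star_mul, star_star]
  simp only [mul_assoc]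

/-- The implementing isometry of a local state belongs to the dual net. -/
theorem IsLocalState.mem_dual_of_implements (hT : 𝔄.IsLocalState Λ T) {O Q : Set M4}
    {W : H →L[ℂ] H} (hW : ∀ X ∈ 𝔄.complAlg O, π (T X) = star W * π X * W)
    (hO : O ⊆ Q) (hΛ : Λ.2 ⊆ Q) : W ∈ 𝔄.dual π Q := by
  have hWX : ∀ X ∈ 𝔄.complAlg Q, ∀ h, W.adjoint (π X (W h)) = π X h := by
    intro X hX h
    have h1 := hW X (complAlg_anti hO hX)
    rw [hT.apply_of_mem (complAlg_anti hΛ hX)] at h1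
    exact (congrArg (fun Z : H →L[ℂ] H => Z h) h1).symm
  rintro _ ⟨B, hB, rfl⟩
  ext h
  refine (intertwines_of_compression (fun h => ?_) (hWX B hB)
    (hWX _ (mul_mem (star_mem hB) hB)) h).symm
  -- That `W` is an isometry is the case `X = 1` of the implementation formula.
  have := hWX 1 (one_mem _) h
  rwa [map_one] at this

end LocalNet

namespace LocalNet

variable {A : Type u} [CStarAlgebra A] {𝔄 : LocalNet A}
  {H : Type v} [NormedAddCommGroup H] [InnerProductSpace ℂ H] [CompleteSpace H]
  {ω : A →ₗ[ℂ] ℂ} {π : A →⋆ₐ[ℂ] (H →L[ℂ] H)} {Ω : H}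
  [PartialOrder A] [StarOrderedRing A] {Λ : Set M4 × Set M4} {T : A →CP A}

theorem IsVacuum.continuous_of_stinespring (hvac : 𝔄.IsVacuum ω π Ω) (hB : 𝔄.PropertyB)
    {K : Type w} [NormedAddCommGroup K] [InnerProductSpace ℂ K] [CompleteSpace K]
    {π₁ : A →⋆ₐ[ℂ] (K →L[ℂ] K)} {V : H →L[ℂ] K}
    (hS : IsMinimalStinespring (fun X => π (T X)) π₁ V) : Continuous T := by
  rw [(hvac.isometry hB).isUniformInducing.isInducing.continuous_iff]
  have hc : Continuous π₁ := map_continuous π₁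
  have : π ∘ T = fun X => V.adjoint ∘L π₁ X ∘L V := funext hS.1
  rw [this]
  fun_prop

/-- A local state with property DHR and transportable endomorphisms is implemented by an isometry
on the causal complement of any translate of an enlarged localization region. -/
theorem IsLocalState.exists_isometry (hT : 𝔄.IsLocalState Λ T) (hΛ : Λ ∈ 𝔄.doubleConePairs)
    (hvac : 𝔄.IsVacuum ω π Ω) (hB : 𝔄.PropertyB) (hHaag : 𝔄.HaagDuality π)
    {K : Type w} [NormedAddCommGroup K] [InnerProductSpace ℂ K] [CompleteSpace K]
    {π₁ : A →⋆ₐ[ℂ] (K →L[ℂ] K)} {V : H →L[ℂ] K}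
    (hS : IsMinimalStinespring (fun X => π (T X)) π₁ V) (hDHR : 𝔄.PropertyDHR π₁)
    (htr : 𝔄.HasTransportableEndomorphisms π Λ.2 T) {p q : M4} (hpq : q - p ∈ forwardCone)
    (hΛ₂ : Λ.2 = doubleCone p q) (a : M4) :
    ∃ W : H →L[ℂ] H,
      ∀ X ∈ 𝔄.complAlg (translateRegion a (doubleCone (p - timeVec) (q + timeVec))),
        π (T X) = star W * π X * W := by
  have hO : IsDoubleCone (doubleCone (p - timeVec) (q + timeVec)) := by
    refine isDoubleCone_doubleCone ?_
    have ht := forwardCone_subset_closedForwardCone timeVec_mem_forwardCone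
    convert add_mem_forwardCone (add_mem_forwardCone hpq ht) ht using 1
    abel
  have hcl : closure Λ.2 ⊂ doubleCone (p - timeVec) (q + timeVec) := by
    rw [hΛ₂]
    exact closure_doubleCone_ssubset hpq
  obtain ⟨ρ, hρ⟩ := hT.exists_corresponds hΛ hvac hB hHaag hS hDHR hO hcl
  exact hρ.exists_isometry (htr _ hO (subset_closure.trans hcl.subset) ρ hρ) a

end LocalNet

/-! ### Commutation of causally separated local states -/

theorem mainTheorem3 {A : Type u} [CStarAlgebra A] [PartialOrder A] [StarOrderedRing A]
    (𝔄 : LocalNet A) (hB : 𝔄.PropertyB)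
    {H₀ : Type v} [NormedAddCommGroup H₀] [InnerProductSpace ℂ H₀] [CompleteSpace H₀]
    [TopologicalSpace.SeparableSpace H₀]
    (ω₀ : A →ₗ[ℂ] ℂ) (π₀ : A →⋆ₐ[ℂ] (H₀ →L[ℂ] H₀)) (Ω : H₀) (hvac : 𝔄.IsVacuum ω₀ π₀ Ω)
    (hHaag : 𝔄.HaagDuality π₀)
    (Λ₁ Λ₂ : Set M4 × Set M4) (hΛ₁ : Λ₁ ∈ 𝔄.doubleConePairs) (hΛ₂ : Λ₂ ∈ 𝔄.doubleConePairs)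
    (hsep : CausallySeparated Λ₁.2 Λ₂.2)
    (T₁ T₂ : A →CP A) (hT₁ : 𝔄.IsLocalState Λ₁ T₁) (hT₂ : 𝔄.IsLocalState Λ₂ T₂)
    {K₁ : Type w} [NormedAddCommGroup K₁] [InnerProductSpace ℂ K₁] [CompleteSpace K₁]
    (π₁ : A →⋆ₐ[ℂ] (K₁ →L[ℂ] K₁)) (V₁ : H₀ →L[ℂ] K₁)
    (hS₁ : IsMinimalStinespring (fun X => π₀ (T₁ X)) π₁ V₁) (hDHR₁ : 𝔄.PropertyDHR π₁)
    {K₂ : Type z} [NormedAddCommGroup K₂] [InnerProductSpace ℂ K₂] [CompleteSpace K₂]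
    (π₂ : A →⋆ₐ[ℂ] (K₂ →L[ℂ] K₂)) (V₂ : H₀ →L[ℂ] K₂)
    (hS₂ : IsMinimalStinespring (fun X => π₀ (T₂ X)) π₂ V₂) (hDHR₂ : 𝔄.PropertyDHR π₂)
    (htr₁ : 𝔄.HasTransportableEndomorphisms π₀ Λ₁.2 T₁)
    (htr₂ : 𝔄.HasTransportableEndomorphisms π₀ Λ₂.2 T₂) :
    (fun X => π₀ ((T₁ ∘ T₂) X)) = fun X => π₀ ((T₂ ∘ T₁) X) := by 
  have hX : ∀ X, π₀ (T₁ (T₂ X)) = π₀ (T₂ (T₁ X)) := by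
    have hc₁ := hvac.continuous_of_stinespring hB hS₁
    have hc₂ := hvac.continuous_of_stinespring hB hS₂
    have hcπ : Continuous π₀ := map_continuous π₀
    refine LocalNet.induction_on_doubleCones (𝔄 := 𝔄)
      (p := fun X => π₀ (T₁ (T₂ X)) = π₀ (T₂ (T₁ X)))
      (isClosed_eq (hcπ.comp (hc₁.comp hc₂)) (hcπ.comp (hc₂.comp hc₁)))
      ((𝔄.bounded_of_mem _ hΛ₁.1.2.1).union (𝔄.bounded_of_mem _ hΛ₂.1.2.1)) ?_
    intro r hr hsub X hX
    obtain ⟨p, q, hpq, hD₁⟩ := hΛ₁.2.2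
    obtain ⟨p', q', hpq', hD₂⟩ := hΛ₂.2.2
    change Λ₁.2 = doubleCone p q at hD₁
    change Λ₂.2 = doubleCone p' q' at hD₂
    have hsep' : CausallySeparated (doubleCone p q) (doubleCone p' q') := hD₁ ▸ hD₂ ▸ hsep
    obtain ⟨a, Q, Q', hQ, hQ', hQQ, hsubQ, hsubQ', htQ, htQ', hR, hR'⟩ :=
      hsep'.exists_translation hpq hpq' r
    obtain ⟨W₁, hW₁⟩ := hT₁.exists_isometry hΛ₁ hvac hB hHaag hS₁ hDHR₁ htr₁ hpq hD₁ a
    obtain ⟨W₂, hW₂⟩ := hT₂.exists_isometry hΛ₂ hvac hB hHaag hS₂ hDHR₂ htr₂ hpq' hD₂ (-a)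
    have hdual₁ := hT₁.mem_dual_of_implements hW₁ htQ (hD₁ ▸ hsubQ)
    have hdual₂ := hT₂.mem_dual_of_implements hW₂ htQ' (hD₂ ▸ hsubQ')
    -- By Haag duality `W₁` lies in `π₀(A(Q))''`, while `W₂` commutes with `π₀(A(Q))` because `A(Q)`
    -- is contained in the algebra of the complement of `Q'`.
    have hcomm : W₁ * W₂ = W₂ * W₁ := by
      rw [hHaag Q hQ] at hdual₁
      refine (hdual₁ W₂ ?_).symm
      exact centralizer_subset (image_mono
        (LocalNet.alg_le_complAlg (𝔄.doubleCone_mem Q hQ) hQQ)) hdual₂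
    have hRd := isDoubleCone_doubleCone (LocalNet.neg_tip_mem_forwardCone hr)
    have hRm := 𝔄.doubleCone_mem _ hRd
    -- The second local state acts on the output of the first, so its implementation formula needs
    -- that output to remain in `A(R)`.
    have h₁ := hT₁.map_mem_alg hvac hB hHaag hRd (subset_union_left.trans hsub) hX
    have h₂ := hT₂.map_mem_alg hvac hB hHaag hRd (subset_union_right.trans hsub) hX
    have hle₁ := LocalNet.alg_le_complAlg hRm hR
    have hle₂ := LocalNet.alg_le_complAlg hRm hR'
    rw [hW₁ _ (hle₁ h₂), hW₂ _ (hle₂ hX), hW₂ _ (hle₂ h₁), hW₁ _ (hle₁ hX)]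
    have hcomm' : star W₂ * star W₁ = star W₁ * star W₂ := by
      rw [← star_mul, ← star_mul, hcomm]
    calc star W₁ * (star W₂ * π₀ X * W₂) * W₁
        = (star W₁ * star W₂) * π₀ X * (W₂ * W₁) := by simp only [mul_assoc]
      _ = (star W₂ * star W₁) * π₀ X * (W₁ * W₂) := by rw [hcomm, hcomm']
      _ = star W₂ * (star W₁ * π₀ X * W₁) * W₂ := by simp only [mul_assoc]
  exact funext hX
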